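/- Let $\mathcal H$ be a complex Hilbert space with inner product $\langle\cdot,\cdot\rangle$ (linear in the first variable), let $\mathcal B$ be its open unit ball and $\partial\mathcal B$ its unit sphere. For $z\in\mathcal B$ and $w\in\overline{\mathcal B}$ put $$d(z,w)=\frac{|1-\langle z,w\rangle|^2}{1-\|z\|^2},\qquad E(w,k)=\{z\in\mathcal B: d(z,w)<k\}.$$ For a self-mapping $F$ of $\mathcal B$, a point $\eta\in\partial\mathcal B$ is a boundary regular fixed point of $F$ if $\lim_{r\to1^-}F(r\eta)=\eta$ and the limit $\lim_{r\to 1^-}\frac{1-\langle F(r\eta),\eta\rangle}{1-r}$ exists and is finite; a point $\eta\in\partial\mathcal B$ is a sink point of $F$ if $F(E(\eta,k))\subseteq E(\eta,k)$ for all $k>0$. A sequence of mappings on $\mathcal B$ converges locally uniformly on $\mathcal B$ if it converges uniformly in norm on each ball contained in $\mathcal B$ that has positive distance from $\partial\mathcal B$. $F^n$ denotes the $n$-th iterate of $F$. Let $F$ be a holomorphic mapping on $\mathcal B$ with $F(\mathcal B)\subseteq E(\tau,m)$ for some $\tau\in\partial\mathcal B$ and $0<m<\infty$, that is, $F(z)\in\mathcal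 B$ and $d(F(z),\tau)<m$ for all $z\in\mathcal B$. Then: (i) $F$ has at most one fixed point in $\mathcal B$. (ii) If $\zeta\in\mathcal B$, $F(\zeta)=\zeta$, and every point of modulus $1$ of the spectrum of the Fréchet derivative $F'(\zeta)$ is an eigenvalue of $F'(\zeta)$, then the iterates $F^n$ converge to $\zeta$ locally uniformly on $\mathcal B$. (iii) If $\eta\in\partial\mathcal B$ is a boundary regular fixed point of $F$, then $\eta=\tau$. (iv) The following are equivalent: $F$ has no fixed point in $\mathcal B$; $\tau$ is a sink point of $F$; the iterates $F^n$ converge to $\tau$ locally uniformly on $\mathcal B$. -/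

import Mathlib

open Filter Topology

noncomputable section

namespace HilbertBall

/-- The open unit ball of a normed space. -/
abbrev unitBall (H : Type*) [SeminormedAddCommGroup H] : Set H := Metric.ball (0 : H) 1

section Geometry

variable {H : Type*} [NormedAddCommGroup H] [InnerProductSpace ℂ H]

/-- The non-euclidean "distance" `d(z,w) = |1 - ⟨z,w⟩|² / (1 - ‖z‖²)` from a point `z` of the open
unit ball to a point `w` of the closed unit ball. Mathlib's `inner ℂ w z` is linear in `z`. -/
def horoDist (z w : H) : ℝ := ‖(1 : ℂ) - inner ℂ w z‖ ^ 2 / (1 - ‖z‖ ^ 2)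

/-- The ellipsoid `E(w,k) = {z ∈ B : d(z,w) < k}`, a horosphere when `‖w‖ = 1`. -/
def ellipsoid (w : H) (k : ℝ) : Set H := {z | z ∈ unitBall H ∧ horoDist z w < k}

/-- `ζ ∈ ∂B` is a boundary fixed point of `F` if `F (r ζ) → ζ` as `r → 1⁻`. -/
def IsBoundaryFixedPoint (F : H → H) (ζ : H) : Prop :=
  ‖ζ‖ = 1 ∧ Tendsto (fun r : ℝ => F ((r : ℂ) • ζ)) (𝓝[<] (1 : ℝ)) (𝓝 ζ)

/-- A boundary fixed point `ζ` is regular if the radial derivative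
`lim_{r → 1⁻} (1 - ⟨F (r ζ), ζ⟩) / (1 - r)` exists finitely. -/
def IsBoundaryRegularFixedPoint (F : H → H) (ζ : H) : Prop :=
  IsBoundaryFixedPoint F ζ ∧
    ∃ L : ℂ, Tendsto (fun r : ℝ => ((1 : ℂ) - inner ℂ ζ (F ((r : ℂ) • ζ))) / ((1 : ℂ) - (r : ℂ)))
      (𝓝[<] (1 : ℝ)) (𝓝 L)

/-- `τ ∈ ∂B` is a sink point of `F` if all the ellipsoids `E(τ,k)`, `k > 0`, are `F`-invariant. -/
def IsSinkPoint (F : H → H) (τ : H) : Prop :=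
  ‖τ‖ = 1 ∧ ∀ k : ℝ, 0 < k → Set.MapsTo F (ellipsoid τ k) (ellipsoid τ k)

end Geometry

section Convergence

variable {X : Type*} [SeminormedAddCommGroup X]

/-- `K ⊆ D` is strictly inside `D` if it is bounded away from the boundary of `D`. -/
def IsStrictlyInside (K D : Set X) : Prop :=
  K ⊆ D ∧ ∃ ε : ℝ, 0 < ε ∧ ∀ z ∈ K, ∀ w ∈ frontier D, ε ≤ ‖z - w‖

/-- Local uniform convergence on `D`: uniform convergence on each ball strictly inside `D`. -/
def LocallyUniformlyConvergesOn (G : ℕ → X → X) (g : X → X) (D : Set X) : Prop :=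
  ∀ (c : X) (r : ℝ), IsStrictlyInside (Metric.ball c r) D →
    TendstoUniformlyOn G g atTop (Metric.ball c r)

end Convergence

section Spectrum

variable {X : Type*} [NormedAddCommGroup X] [NormedSpace ℂ X]

/-- The peripheral spectrum: the spectral values of modulus one. -/
def peripheralSpectrum (A : X →L[ℂ] X) : Set ℂ := {μ | μ ∈ spectrum ℂ A ∧ ‖μ‖ = 1}

/-- The point spectrum: the spectral values that are eigenvalues. -/
def pointSpectrum (A : X →L[ℂ] X) : Set ℂ :=
  {μ | μ ∈ spectrum ℂ A ∧ Module.End.HasEigenvalue (A : X →ₗ[ℂ] X) μ}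

end Spectrum

end HilbertBall

end

/-!
The proof rests on the Schwarz-Pick inequality for the ball of a Hilbert space
(`sigma_le_sigma_map`): with `σ(x,y) = (1 - ‖x‖²)(1 - ‖y‖²) / |1 - ⟨x,y⟩|²`, a holomorphic self-map
satisfies `σ(x,y) ≤ σ(F x, F y)`. It follows from the Schwarz lemma at the origin, since the
automorphism `mobius a` interchanges `0` and `a` and satisfies `1 - ‖mobius a z‖² = σ(a,z)`. The
hypothesis `F(B) ⊆ E(τ,m)` is used in two ways: points of `E(τ,m)` that converge to the unit sphere
converge to `τ` (`eq_of_tendsto_of_mem_ellipsoid`), and `E(τ,m)` is itself a copy of the ball under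
a parabolic map.

*Fixed points in the ball.* Move the fixed point `ζ` to the origin. By the equality case of the
Schwarz lemma, a second fixed point, or a unimodular eigenvalue of `F'(ζ)`, would make the
recentered map isometric on a whole disc through `0`; along two opposite radii of this disc the values of `F`
would tend to two different points of the sphere, but both limits have to be `τ`
(`not_forall_recenter_smul_eq`). Hence there is at most one fixed point, and under the spectral
hypothesis the spectral radius of `F'(ζ)` is less than `1`. Some iterate of the recentered map then
has a derivative of norm less than `1` at `0`, and the Schwarz-Pick inequality for its slopes shows
that it contracts each smaller ball by a fixed factor (`norm_map_le_of_norm_fderiv_le`).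

*No fixed point implies a sink point.* For `t < 1` the map `t F` is a strict contraction for the
pseudo-hyperbolic distance and has a fixed point `z_t` (`exists_fixedPoint_of_norm_le`). Comparing
two of these through the Schwarz-Pick inequality gives
`‖z_s - z_t‖² ≤ |‖z_s‖² - ‖z_t‖²|` (`norm_sub_sq_le_abs_of_sigma_le`), which replaces compactness:
some sequence `z_t`, `t → 1`, converges in norm. A limit inside the ball would be a fixed point, so
the limit is `τ`, and the Schwarz-Pick inequality at `z_t` becomes
`horoDist (F x) τ ≤ horoDist x τ` in the limit.

*A sink point implies convergence.* In the Siegel half-space picture, `1 / horoDist · τ` is the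
height above the boundary, and `E(τ,m)` is the half-space of height `1 / m`. Lowering the values of `F` by
`1 / m` gives another self-map of the ball, which by the limit form of the Schwarz-Pick inequality
along the radius to `τ` does not decrease heights either. So `F` raises heights by at least `1 / m`
(`inv_horoDist_map_ge`), `horoDist (F^n z) τ ≤ m / n` for all `z`, and `F^n → τ` uniformly.
-/

noncomputable section

namespace HilbertBall

variable {H : Type*} [NormedAddCommGroup H] [InnerProductSpace ℂ H]
variable {H' : Type*} [NormedAddCommGroup H'] [InnerProductSpace ℂ H']

/-! ### Automorphisms of the ball and the Schwarz-Pick inequality -/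

lemma norm_inner_lt_one {a z : H} (ha : ‖a‖ < 1) (hz : ‖z‖ ≤ 1) : ‖inner ℂ a z‖ < 1 := by
  have h1 := norm_inner_le_norm (𝕜 := ℂ) a z
  nlinarith [norm_nonneg a, norm_nonneg z]

lemma norm_inner_lt_one' {a z : H} (ha : ‖a‖ ≤ 1) (hz : ‖z‖ < 1) : ‖inner ℂ a z‖ < 1 := by
  rw [norm_inner_symm]
  exact norm_inner_lt_one hz ha

lemma one_sub_ne_zero_of_norm_lt_one {p : ℂ} (hp : ‖p‖ < 1) : 1 - p ≠ 0 := by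
  intro h
  rw [← sub_eq_zero.mp h, norm_one] at hp
  exact lt_irrefl _ hp

lemma norm_one_sub_pos {p : ℂ} (hp : ‖p‖ < 1) : 0 < ‖1 - p‖ :=
  norm_pos_iff.mpr (one_sub_ne_zero_of_norm_lt_one hp)

lemma one_sub_norm_sq_pos {E : Type*} [SeminormedAddCommGroup E] {z : E} (hz : ‖z‖ < 1) :
    0 < 1 - ‖z‖ ^ 2 := by
  nlinarith [norm_nonneg z]

/-- The invariant `σ(x,y) = (1 - ‖x‖²)(1 - ‖y‖²) / |1 - ⟨x,y⟩|²` of a pair of points of the ball;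
`√(1 - σ(x,y))` is their pseudo-hyperbolic distance. -/
def sigma (x y : H) : ℝ := (1 - ‖x‖ ^ 2) * (1 - ‖y‖ ^ 2) / ‖1 - inner ℂ x y‖ ^ 2

/-- The involutive automorphism of the ball that interchanges `0` and `a`,
`z ↦ (a - P z - s Q z) / (1 - ⟨z,a⟩)` with `s = √(1 - ‖a‖²)`, `P` the orthogonal projection to
`ℂ a` and `Q = 1 - P`. Since `1 - s² = ‖a‖²`, one has `P z + s Q z = s z + ⟨z,a⟩ / (1 + s) a`; in
this form no case distinction is needed at `a = 0`. -/
def mobius (a z : H) : H :=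
  (1 - inner ℂ a z)⁻¹ •
    ((1 - inner ℂ a z / (1 + (√(1 - ‖a‖ ^ 2) : ℂ))) • a - (√(1 - ‖a‖ ^ 2) : ℂ) • z)

lemma norm_smul_sub_smul_sq (a z : H) (α : ℂ) (s : ℝ) :
    ‖α • a - (s : ℂ) • z‖ ^ 2 =
      ‖α‖ ^ 2 * ‖a‖ ^ 2 - 2 * s * ((starRingEnd ℂ) α * inner ℂ a z).re + s ^ 2 * ‖z‖ ^ 2 := by
  rw [norm_sub_sq (𝕜 := ℂ), inner_smul_left, inner_smul_right, norm_smul, norm_smul]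
  have : RCLike.re ((starRingEnd ℂ) α * (↑s * inner ℂ a z)) =
      s * ((starRingEnd ℂ) α * inner ℂ a z).re := by
    rw [mul_left_comm]
    exact Complex.re_ofReal_mul _ _
  rw [this, mul_pow, mul_pow, Complex.norm_real, Real.norm_eq_abs, sq_abs]
  ring

lemma one_sub_norm_mobius_sq {a z : H} (ha : ‖a‖ < 1) (hz : ‖z‖ ≤ 1) :
    1 - ‖mobius a z‖ ^ 2 = sigma a z := by
  have hD := norm_one_sub_pos (norm_inner_lt_one ha hz)
  have hA := one_sub_norm_sq_pos ha
  rw [sigma, mobius, norm_smul, mul_pow, norm_inv, eq_div_iff (by positivity)]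
  set s := √(1 - ‖a‖ ^ 2) with hs
  have hs0 : 0 ≤ s := Real.sqrt_nonneg _
  have hs2 : s ^ 2 = 1 - ‖a‖ ^ 2 := Real.sq_sqrt hA.le
  have hA2 : ‖a‖ ^ 2 = 1 - s ^ 2 := by linarith
  have hs1 : (1 + (s : ℂ)) ≠ 0 := by
    rw [← Complex.ofReal_one, ← Complex.ofReal_add, Complex.ofReal_ne_zero]
    positivity
  obtain ⟨k, hk⟩ : ∃ k : ℂ, inner ℂ a z = (1 + s) * k :=
    ⟨inner ℂ a z / (1 + s), by field_simp⟩
  rw [norm_smul_sub_smul_sq]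
  have key : ‖1 - inner ℂ a z‖ ^ 2 - (‖1 - inner ℂ a z / (1 + (s : ℂ))‖ ^ 2 * ‖a‖ ^ 2 -
      2 * s * ((starRingEnd ℂ) (1 - inner ℂ a z / (1 + (s : ℂ))) * inner ℂ a z).re
        + s ^ 2 * ‖z‖ ^ 2) = (1 - ‖a‖ ^ 2) * (1 - ‖z‖ ^ 2) := by
    rw [hk, mul_div_cancel_left₀ _ hs1, hA2]
    simp only [← Complex.normSq_eq_norm_sq, Complex.normSq_apply, Complex.sub_re, Complex.sub_im,
      Complex.mul_re, Complex.mul_im, Complex.add_re, Complex.add_im, Complex.one_re,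
      Complex.one_im, Complex.ofReal_re, Complex.ofReal_im, Complex.conj_re, Complex.conj_im]
    ring
  rw [← key]
  field_simp

lemma sigma_pos {x y : H} (hx : ‖x‖ < 1) (hy : ‖y‖ < 1) : 0 < sigma x y := by
  have := norm_one_sub_pos (norm_inner_lt_one hx hy.le)
  have := one_sub_norm_sq_pos hx
  have := one_sub_norm_sq_pos hy
  unfold sigma
  positivity

lemma norm_mobius_lt_one {a z : H} (ha : ‖a‖ < 1) (hz : ‖z‖ < 1) : ‖mobius a z‖ < 1 := by
  have h := one_sub_norm_mobius_sq ha hz.le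
  have := sigma_pos ha hz
  by_contra! hc
  nlinarith

lemma norm_mobius_eq_one {a z : H} (ha : ‖a‖ < 1) (hz : ‖z‖ = 1) : ‖mobius a z‖ = 1 := by
  have h := one_sub_norm_mobius_sq ha hz.le
  rw [sigma, hz] at h
  have h2 : ‖mobius a z‖ ^ 2 = 1 := by norm_num at h; linarith
  exact (pow_eq_one_iff_of_nonneg (norm_nonneg _) two_ne_zero).mp h2

@[simp] lemma mobius_zero (a : H) : mobius a 0 = a := by simp [mobius]

lemma mobius_mobius {a z : H} (ha : ‖a‖ < 1) (hz : ‖z‖ ≤ 1) : mobius a (mobius a z) = z := by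
  have hD := one_sub_ne_zero_of_norm_lt_one (norm_inner_lt_one ha hz)
  have hA := one_sub_norm_sq_pos ha
  have hip : inner ℂ a (mobius a z) = (1 - inner ℂ a z)⁻¹ *
      ((1 - inner ℂ a z / (1 + (√(1 - ‖a‖ ^ 2) : ℂ))) * (‖a‖ : ℂ) ^ 2
        - (√(1 - ‖a‖ ^ 2) : ℂ) * inner ℂ a z) := by
    rw [mobius, inner_smul_right, inner_sub_right, inner_smul_right, inner_smul_right,
      inner_self_eq_norm_sq_to_K]
    rfl
  rw [mobius, hip, mobius]
  set s := √(1 - ‖a‖ ^ 2) with hs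
  have hs0 : 0 < s := Real.sqrt_pos.mpr hA
  have hs2 : s ^ 2 = 1 - ‖a‖ ^ 2 := Real.sq_sqrt hA.le
  have hA2 : (‖a‖ : ℂ) ^ 2 = 1 - (s : ℂ) ^ 2 := by
    rw [← Complex.ofReal_pow, ← Complex.ofReal_pow, hs2]
    push_cast
    ring
  have hs1 : (1 + (s : ℂ)) ≠ 0 := by
    rw [← Complex.ofReal_one, ← Complex.ofReal_add, Complex.ofReal_ne_zero]
    positivity
  have hsne : (s : ℂ) ≠ 0 := Complex.ofReal_ne_zero.mpr hs0.ne'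
  obtain ⟨k, hk⟩ : ∃ k : ℂ, inner ℂ a z = (1 + s) * k :=
    ⟨inner ℂ a z / (1 + s), by field_simp⟩
  rw [hk] at hD ⊢
  rw [hA2, mul_div_cancel_left₀ _ hs1]
  set D := 1 - (1 + (s : ℂ)) * k with hDdef
  have e1 : D⁻¹ * ((1 - k) * (1 - (s : ℂ) ^ 2) - s * ((1 + s) * k)) = 1 - s ^ 2 / D := by
    field_simp
    rw [hDdef]
    ring
  have e2 : 1 - (1 - (s : ℂ) ^ 2 / D) = s ^ 2 / D := by ring
  rw [e1, e2]
  simp only [smul_sub, smul_smul]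
  rw [← sub_add, ← sub_smul]
  have e3 : ((s : ℂ) ^ 2 / D)⁻¹ * (1 - (1 - s ^ 2 / D) / (1 + s)) -
      ((s : ℂ) ^ 2 / D)⁻¹ * (s * (D⁻¹ * (1 - k))) = 0 := by
    have : (1 - (1 - (s : ℂ) ^ 2 / D) / (1 + s)) = s * (D⁻¹ * (1 - k)) := by
      field_simp
      rw [hDdef]
      ring
    rw [this, sub_self]
  have e4 : ((s : ℂ) ^ 2 / D)⁻¹ * (s * (D⁻¹ * s)) = 1 := by
    field_simp
  rw [e3, zero_smul, zero_add, e4, one_smul]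

lemma mobius_self {a : H} (ha : ‖a‖ < 1) : mobius a a = 0 := by
  simpa using mobius_mobius ha (z := 0) (by simp)

lemma differentiableAt_mobius {a z : H} (ha : ‖a‖ < 1) (hz : ‖z‖ ≤ 1) :
    DifferentiableAt ℂ (mobius a) z := by
  have hD := one_sub_ne_zero_of_norm_lt_one (norm_inner_lt_one ha hz)
  have hin : DifferentiableAt ℂ (fun w : H => inner ℂ a w) z :=
    (innerSL ℂ a).differentiableAt
  simp only [funext fun w => mobius.eq_1 a w, div_eq_mul_inv]
  exact ((hin.const_sub 1).inv hD).smul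
    ((((hin.mul_const _).const_sub 1).smul_const a).sub (differentiableAt_id.const_smul _))

lemma mapsTo_mobius {a : H} (ha : ‖a‖ < 1) :
    Set.MapsTo (mobius a) (unitBall H) (unitBall H) := fun z hz => by
  rw [mem_ball_zero_iff] at hz ⊢
  exact norm_mobius_lt_one ha hz

lemma differentiableOn_mobius {a : H} (ha : ‖a‖ < 1) :
    DifferentiableOn ℂ (mobius a) (unitBall H) := fun z hz =>
  (differentiableAt_mobius ha (by simpa using (mem_ball_zero_iff.mp hz).le)).differentiableWithinAt

/-- The **Schwarz-Pick inequality** for balls of Hilbert spaces: a holomorphic map does not increase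
the pseudo-hyperbolic distance. It is the Schwarz lemma for `F` composed with automorphisms that
move the base points to the origin. -/
theorem sigma_le_sigma_map {F : H → H'} (hF : DifferentiableOn ℂ F (unitBall H))
    (hmaps : Set.MapsTo F (unitBall H) (unitBall H')) {x y : H} (hx : ‖x‖ < 1) (hy : ‖y‖ < 1) :
    sigma x y ≤ sigma (F x) (F y) := by
  have hFx : ‖F x‖ < 1 := mem_ball_zero_iff.mp (hmaps (mem_ball_zero_iff.mpr hx))
  have hFy : ‖F y‖ < 1 := mem_ball_zero_iff.mp (hmaps (mem_ball_zero_iff.mpr hy))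
  have hmapsG : Set.MapsTo (mobius (F x) ∘ F ∘ mobius x) (unitBall H) (unitBall H') :=
    (mapsTo_mobius hFx).comp (hmaps.comp (mapsTo_mobius hx))
  have hG : DifferentiableOn ℂ (mobius (F x) ∘ F ∘ mobius x) (unitBall H) :=
    (differentiableOn_mobius hFx).comp
      (hF.comp (differentiableOn_mobius hx) (mapsTo_mobius hx))
      (hmaps.comp (mapsTo_mobius hx))
  have key := Complex.norm_le_norm_of_mapsTo_ball hG
    (hmapsG.mono_right Metric.ball_subset_closedBall)
    (by simp [mobius_self hFx]) (norm_mobius_lt_one hx hy)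
  simp only [Function.comp_apply, mobius_mobius hx hy.le] at key
  rw [← one_sub_norm_mobius_sq hx hy.le, ← one_sub_norm_mobius_sq hFx hFy.le]
  have := pow_le_pow_left₀ (norm_nonneg _) key 2
  linarith

/-! ### Strict contraction and fixed points of maps into smaller balls -/

lemma norm_one_sub_inner_add_sq_sub (u w : H) :
    ‖1 - inner ℂ u (u + w)‖ ^ 2 - (1 - ‖u‖ ^ 2) * (1 - ‖u + w‖ ^ 2) =
      ‖inner ℂ u w‖ ^ 2 + (1 - ‖u‖ ^ 2) * ‖w‖ ^ 2 := by
  rw [norm_add_sq (𝕜 := ℂ), inner_add_right, inner_self_eq_norm_sq_to_K]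
  generalize inner ℂ u w = q
  have h1 : (1 : ℂ) - (((‖u‖ : ℝ) : ℂ) ^ 2 + q) = ((1 - ‖u‖ ^ 2 : ℝ) : ℂ) - q := by
    push_cast
    ring
  have h2 : RCLike.re q = q.re := rfl
  erw [h1]
  rw [h2, ← Complex.normSq_eq_norm_sq, ← Complex.normSq_eq_norm_sq, Complex.normSq_apply,
    Complex.normSq_apply, Complex.sub_re, Complex.sub_im, Complex.ofReal_re, Complex.ofReal_im]
  ring

lemma one_sub_sigma {u v : H} (hu : ‖u‖ < 1) (hv : ‖v‖ ≤ 1) :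
    1 - sigma u v = (‖inner ℂ u (v - u)‖ ^ 2 + (1 - ‖u‖ ^ 2) * ‖v - u‖ ^ 2) /
      ‖1 - inner ℂ u v‖ ^ 2 := by
  have h := norm_one_sub_inner_add_sq_sub u (v - u)
  rw [add_sub_cancel] at h
  have hD := norm_one_sub_pos (norm_inner_lt_one hu hv)
  rw [← h, sigma]
  field_simp

lemma norm_one_sub_inner_le_two {u v : H} (hu : ‖u‖ ≤ 1) (hv : ‖v‖ ≤ 1) :
    ‖1 - inner ℂ u v‖ ≤ 2 := by
  have h1 := norm_inner_le_norm (𝕜 := ℂ) u v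
  have h2 := norm_sub_le (1 : ℂ) (inner ℂ u v)
  rw [norm_one] at h2
  nlinarith [norm_nonneg u, norm_nonneg v]

lemma norm_sub_sq_le_of_sigma {u v : H} (hu : ‖u‖ < 1) (hv : ‖v‖ ≤ 1) :
    (1 - ‖u‖ ^ 2) * ‖v - u‖ ^ 2 ≤ 4 * (1 - sigma u v) := by
  have hD := norm_one_sub_pos (norm_inner_lt_one hu hv)
  have hD2 := norm_one_sub_inner_le_two hu.le hv
  have h0 := one_sub_norm_sq_pos hu
  have h : 0 ≤ 1 - sigma u v := by
    rw [one_sub_sigma hu hv]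
    positivity
  have h1 : (1 - sigma u v) * ‖1 - inner ℂ u v‖ ^ 2 =
      ‖inner ℂ u (v - u)‖ ^ 2 + (1 - ‖u‖ ^ 2) * ‖v - u‖ ^ 2 := by
    rw [one_sub_sigma hu hv]
    field_simp
  have h3 : ‖1 - inner ℂ u v‖ ^ 2 ≤ 4 := by nlinarith
  nlinarith [sq_nonneg ‖inner ℂ u (v - u)‖]

lemma norm_inner_sub_le {u v : H} (hu : ‖u‖ ≤ 1) (hv : ‖v‖ ≤ 1) :
    ‖inner ℂ u (v - u)‖ ≤ ‖u‖ * ‖1 - inner ℂ u v‖ := by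
  have h := norm_one_sub_inner_add_sq_sub u (v - u)
  rw [add_sub_cancel] at h
  have hq := pow_le_pow_left₀ (norm_nonneg _) (norm_inner_le_norm (𝕜 := ℂ) u (v - u)) 2
  rw [mul_pow] at hq
  have h1 : 0 ≤ 1 - ‖u‖ ^ 2 := by nlinarith [norm_nonneg u]
  have h2 : 0 ≤ 1 - ‖v‖ ^ 2 := by nlinarith [norm_nonneg v]
  have h3 : ‖inner ℂ u (v - u)‖ ^ 2 + (1 - ‖u‖ ^ 2) * ‖v - u‖ ^ 2 ≤ ‖1 - inner ℂ u v‖ ^ 2 := by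
    nlinarith [mul_nonneg h1 h2]
  refine le_of_sq_le_sq ?_ (by positivity)
  rw [mul_pow]
  nlinarith [mul_le_mul_of_nonneg_left hq h1, mul_le_mul_of_nonneg_left h3 (sq_nonneg ‖u‖)]

/-- Moving `v` away from `u` along the real line through `u` and `v` by the Euclidean factor
`1 + δ` increases the pseudo-hyperbolic distance to `u` at least by the factor
`(1 + δ) / (1 + δ t)`, if `‖u‖ ≤ t`. -/
lemma one_sub_sigma_le_of_dilation {u v : H} {t δ : ℝ} (ht : t < 1) (hδ : 0 < δ) (hu : ‖u‖ ≤ t)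
    (hv : ‖v‖ ≤ 1) (hv' : ‖u + ((1 + δ : ℝ) : ℂ) • (v - u)‖ ≤ 1) :
    1 - sigma u v ≤ ((1 + δ * t) / (1 + δ)) ^ 2 *
      (1 - sigma u (u + ((1 + δ : ℝ) : ℂ) • (v - u))) := by
  have hu1 : ‖u‖ < 1 := hu.trans_lt ht
  have ht0 : 0 ≤ t := (norm_nonneg u).trans hu
  have hq : ‖inner ℂ u (v - u)‖ ≤ t * ‖1 - inner ℂ u v‖ :=
    (norm_inner_sub_le hu1.le hv).trans (by gcongr)
  have hD := norm_one_sub_pos (norm_inner_lt_one hu1 hv)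
  have hD' := norm_one_sub_pos (norm_inner_lt_one hu1 hv')
  have h0 := one_sub_norm_sq_pos hu1
  rw [one_sub_sigma hu1 hv, one_sub_sigma hu1 hv', add_sub_cancel_left, inner_smul_right, norm_smul,
    norm_mul, Complex.norm_real, Real.norm_of_nonneg (by positivity)]
  have hle : ‖1 - inner ℂ u (u + ((1 + δ : ℝ) : ℂ) • (v - u))‖ ≤
      (1 + δ * t) * ‖1 - inner ℂ u v‖ := by
    have e : 1 - inner ℂ u (u + ((1 + δ : ℝ) : ℂ) • (v - u)) =
        (1 - inner ℂ u v) - (δ : ℂ) * inner ℂ u (v - u) := by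
      rw [inner_add_right, inner_smul_right, inner_sub_right]
      push_cast
      ring
    rw [e]
    refine (norm_sub_le _ _).trans ?_
    rw [norm_mul, Complex.norm_real, Real.norm_of_nonneg hδ.le]
    nlinarith
  set D := ‖1 - inner ℂ u v‖
  set D' := ‖1 - inner ℂ u (u + ((1 + δ : ℝ) : ℂ) • (v - u))‖
  set n := ‖inner ℂ u (v - u)‖
  have e2 : ((1 + δ * t) / (1 + δ)) ^ 2 *
      ((((1 + δ) * n) ^ 2 + (1 - ‖u‖ ^ 2) * ((1 + δ) * ‖v - u‖) ^ 2) / D' ^ 2) =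
      (n ^ 2 + (1 - ‖u‖ ^ 2) * ‖v - u‖ ^ 2) * ((1 + δ * t) ^ 2 / D' ^ 2) := by
    field_simp
  rw [e2, div_eq_mul_inv]
  gcongr
  rw [← one_div, div_le_div_iff₀ (by positivity) (by positivity), one_mul, ← mul_pow]
  gcongr

/-- A holomorphic map of the ball into the ball of radius `t < 1` is a strict contraction for the
pseudo-hyperbolic distance: by the Schwarz-Pick inequality for the dilated map
`z ↦ G z + δ (G z - G x)`, still a self-map of the ball. -/
lemma one_sub_sigma_map_le {G : H → H} {t : ℝ} (ht : t < 1)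
    (hG : DifferentiableOn ℂ G (unitBall H)) (hGt : ∀ z, ‖z‖ < 1 → ‖G z‖ ≤ t)
    {x y : H} (hx : ‖x‖ < 1) (hy : ‖y‖ < 1) :
    1 - sigma (G x) (G y) ≤
      ((1 + (1 - t) / 2 * t) / (1 + (1 - t) / 2)) ^ 2 * (1 - sigma x y) := by
  set δ := (1 - t) / 2 with hδdef
  have ht0 : 0 ≤ t := (norm_nonneg _).trans (hGt x hx)
  have hδ : 0 < δ := by linarith
  set g : H → H := fun z => G x + ((1 + δ : ℝ) : ℂ) • (G z - G x) with hgdef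
  have hgd : DifferentiableOn ℂ g (unitBall H) :=
    ((hG.sub_const _).const_smul _).const_add _
  have hgm : ∀ z, ‖z‖ < 1 → ‖g z‖ < 1 := by
    intro z hz
    have e : g z = G z + (δ : ℂ) • (G z - G x) := by
      simp only [hgdef]
      push_cast
      module
    rw [e]
    have h1 := norm_add_le (G z) ((δ : ℂ) • (G z - G x))
    rw [norm_smul, Complex.norm_real, Real.norm_of_nonneg hδ.le] at h1
    have h2 := (norm_sub_le (G z) (G x)).trans (add_le_add (hGt z hz) (hGt x hx))
    have h3 := hGt z hz
    nlinarith [mul_le_mul_of_nonneg_left h2 hδ.le, sq_pos_of_pos hδ]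
  have hsp := sigma_le_sigma_map hgd
    (fun z hz => mem_ball_zero_iff.mpr (hgm z (mem_ball_zero_iff.mp hz))) hx hy
  have hgx : g x = G x := by simp [hgdef]
  rw [hgx] at hsp
  refine (one_sub_sigma_le_of_dilation ht hδ (hGt x hx) ((hGt y hy).trans ht.le)
    (hgm y hy).le).trans ?_
  gcongr

/-- The **Earle-Hamilton fixed point theorem** for balls of Hilbert spaces. -/
theorem exists_fixedPoint_of_norm_le [CompleteSpace H] {G : H → H} {t : ℝ} (ht : t < 1)
    (hG : DifferentiableOn ℂ G (unitBall H)) (hGt : ∀ z, ‖z‖ < 1 → ‖G z‖ ≤ t) :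
    ∃ z, ‖z‖ < 1 ∧ G z = z := by
  have ht0 : 0 ≤ t := (norm_nonneg _).trans (hGt 0 (by simp))
  set κ := (1 + (1 - t) / 2 * t) / (1 + (1 - t) / 2) with hκ
  have hκ0 : 0 ≤ κ := div_nonneg (by nlinarith) (by linarith)
  have hκ1 : κ < 1 := by
    rw [hκ, div_lt_one (by linarith)]
    nlinarith
  have hw : ∀ n, ‖G^[n] 0‖ ≤ t := by
    intro n
    induction n with
    | zero => simpa using ht0
    | succ n ih =>
      rw [Function.iterate_succ_apply']
      exact hGt _ (ih.trans_lt ht)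
  have hσ : ∀ n, 1 - sigma (G^[n] 0) (G^[n + 1] 0) ≤ (κ ^ n) ^ 2 := by
    intro n
    induction n with
    | zero =>
      have := (sigma_pos (x := (0 : H)) (y := G 0) (by simp) ((hw 1).trans_lt ht)).le
      simpa using this
    | succ n ih =>
      rw [Function.iterate_succ_apply' G n, Function.iterate_succ_apply' G (n + 1)]
      refine (one_sub_sigma_map_le ht hG hGt ((hw n).trans_lt ht) ((hw (n + 1)).trans_lt ht)).trans
        ?_
      exact (mul_le_mul_of_nonneg_left ih (sq_nonneg κ)).trans_eq (by ring)
  have hc : 0 < 1 - t ^ 2 := by nlinarith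
  have hdist : ∀ n, dist (G^[n] 0) (G^[n + 1] 0) ≤ 2 / √(1 - t ^ 2) * κ ^ n := by
    intro n
    have h1 := norm_sub_sq_le_of_sigma ((hw n).trans_lt ht) ((hw (n + 1)).trans ht.le)
    rw [dist_comm, dist_eq_norm]
    refine le_of_sq_le_sq ?_ (by positivity)
    rw [mul_pow, div_pow, Real.sq_sqrt hc.le, div_mul_eq_mul_div, le_div_iff₀ hc]
    have h2 : ‖G^[n] 0‖ ^ 2 ≤ t ^ 2 := pow_le_pow_left₀ (norm_nonneg _) (hw n) 2
    nlinarith [hσ n, sq_nonneg ‖G^[n + 1] 0 - G^[n] 0‖]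
  obtain ⟨z, hz⟩ := cauchySeq_tendsto_of_complete (cauchySeq_of_le_geometric κ _ hκ1 hdist)
  have hzt : ‖z‖ ≤ t := le_of_tendsto hz.norm (Eventually.of_forall hw)
  have hz1 : ‖z‖ < 1 := hzt.trans_lt ht
  refine ⟨z, hz1, ?_⟩
  have hcont : ContinuousAt G z :=
    (hG.differentiableAt (Metric.isOpen_ball.mem_nhds (mem_ball_zero_iff.mpr hz1))).continuousAt
  exact isFixedPt_of_tendsto_iterate hz hcont

/-! ### Horospheres and the limit form of the Schwarz-Pick inequality -/

lemma norm_sub_sq_le_norm_one_sub_inner {z τ : H} (hz : ‖z‖ ≤ 1) (hτ : ‖τ‖ = 1) :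
    ‖z - τ‖ ^ 2 ≤ 2 * ‖1 - inner ℂ τ z‖ := by
  rw [← norm_neg (z - τ), neg_sub, norm_sub_sq (𝕜 := ℂ), hτ]
  have h1 : (1 - inner ℂ τ z : ℂ).re ≤ ‖1 - inner ℂ τ z‖ := Complex.re_le_norm _
  rw [Complex.sub_re, Complex.one_re] at h1
  have h2 : RCLike.re (inner ℂ τ z) = (inner ℂ τ z : ℂ).re := rfl
  rw [h2]
  nlinarith [norm_nonneg z]

/-- A limit on the unit sphere of points of the horosphere `E(τ,m)` can only be `τ`. -/
lemma eq_of_tendsto_of_mem_ellipsoid {ι : Type*} {l : Filter ι} [l.NeBot] {u : ι → H} {w τ : H}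
    {m : ℝ} (hτ : ‖τ‖ = 1) (hu : ∀ᶠ i in l, u i ∈ ellipsoid τ m) (hw : ‖w‖ = 1)
    (h : Tendsto u l (𝓝 w)) : w = τ := by
  have h1 : Tendsto (fun i => ‖1 - inner ℂ τ (u i)‖ ^ 2) l (𝓝 (‖1 - inner ℂ τ w‖ ^ 2)) :=
    ((tendsto_const_nhds.inner h).const_sub 1).norm.pow 2
  have h2 : Tendsto (fun i => m * (1 - ‖u i‖ ^ 2)) l (𝓝 (m * (1 - ‖w‖ ^ 2))) :=
    ((h.norm.pow 2).const_sub 1).const_mul m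
  have h3 : ‖1 - inner ℂ τ w‖ ^ 2 ≤ m * (1 - ‖w‖ ^ 2) := by
    refine le_of_tendsto_of_tendsto h1 h2 ?_
    filter_upwards [hu] with i hi
    have hp := one_sub_norm_sq_pos (mem_ball_zero_iff.mp hi.1)
    exact ((div_lt_iff₀ hp).mp hi.2).le
  rw [hw, one_pow, sub_self, mul_zero] at h3
  have h4 : (1 : ℂ) - inner ℂ τ w = 0 := by
    rw [← norm_eq_zero]
    exact pow_eq_zero_iff two_ne_zero |>.mp (le_antisymm h3 (sq_nonneg _))
  exact ((inner_eq_one_iff_of_norm_eq_one hτ hw).mp (sub_eq_zero.mp h4).symm).symm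

lemma horoDist_pos {z τ : H} (hτ : ‖τ‖ = 1) (hz : ‖z‖ < 1) : 0 < horoDist z τ := by
  have := norm_one_sub_pos (norm_inner_lt_one' hτ.le hz)
  have := one_sub_norm_sq_pos hz
  unfold horoDist
  positivity

lemma norm_sub_pow_four_le_horoDist {z τ : H} (hτ : ‖τ‖ = 1) (hz : ‖z‖ < 1) :
    ‖z - τ‖ ^ 4 ≤ 4 * horoDist z τ := by
  have h1 := pow_le_pow_left₀ (sq_nonneg _) (norm_sub_sq_le_norm_one_sub_inner hz.le hτ) 2
  have hp := one_sub_norm_sq_pos hz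
  have h2 : ‖1 - inner ℂ τ z‖ ^ 2 ≤ horoDist z τ := by
    rw [horoDist, le_div_iff₀ hp]
    nlinarith [mul_nonneg (sq_nonneg ‖1 - inner ℂ τ z‖) (sq_nonneg ‖z‖)]
  nlinarith

/-- The limit form of the Schwarz-Pick inequality: if one of the two points tends to `τ`, together
with its image, and the ratio of their `1 - ‖·‖²` is asymptotically at most `1`, then the horosphere
distance to `τ` does not increase. -/
lemma inv_horoDist_le_of_tendsto {x w τ : H} {xs ys ws : ℕ → H} {β : ℕ → ℝ} (hτ : ‖τ‖ = 1)
    (hx : ‖x‖ < 1) (hw : ‖w‖ < 1) (hxs1 : ∀ n, ‖xs n‖ < 1) (hws1 : ∀ n, ‖ws n‖ < 1)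
    (hxs : Tendsto xs atTop (𝓝 τ)) (hys : Tendsto ys atTop (𝓝 τ)) (hws : Tendsto ws atTop (𝓝 w))
    (hβ : Tendsto β atTop (𝓝 1)) (hσ : ∀ n, sigma (xs n) x ≤ sigma (ys n) (ws n))
    (hratio : ∀ n, 1 - ‖ys n‖ ^ 2 ≤ β n * (1 - ‖xs n‖ ^ 2)) :
    (horoDist x τ)⁻¹ ≤ (horoDist w τ)⁻¹ := by
  have hDx : ‖1 - inner ℂ τ x‖ ^ 2 ≠ 0 :=
    pow_ne_zero _ (norm_one_sub_pos (norm_inner_lt_one' hτ.le hx)).ne'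
  have hDw : ‖1 - inner ℂ τ w‖ ^ 2 ≠ 0 :=
    pow_ne_zero _ (norm_one_sub_pos (norm_inner_lt_one' hτ.le hw)).ne'
  have h1 : Tendsto (fun n => (1 - ‖x‖ ^ 2) / ‖1 - inner ℂ (xs n) x‖ ^ 2) atTop
      (𝓝 ((1 - ‖x‖ ^ 2) / ‖1 - inner ℂ τ x‖ ^ 2)) :=
    tendsto_const_nhds.div (((hxs.inner tendsto_const_nhds).const_sub 1).norm.pow 2) hDx
  have h2 : Tendsto (fun n => (1 - ‖ws n‖ ^ 2) / ‖1 - inner ℂ (ys n) (ws n)‖ ^ 2 * β n) atTop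
      (𝓝 ((1 - ‖w‖ ^ 2) / ‖1 - inner ℂ τ w‖ ^ 2 * 1)) :=
    (((hws.norm.pow 2).const_sub 1).div (((hys.inner hws).const_sub 1).norm.pow 2) hDw).mul hβ
  rw [horoDist, horoDist, inv_div, inv_div, ← mul_one ((1 - ‖w‖ ^ 2) / _)]
  refine le_of_tendsto_of_tendsto' h1 h2 fun n => ?_
  have hp := one_sub_norm_sq_pos (hxs1 n)
  have hpw := one_sub_norm_sq_pos (hws1 n)
  refine le_of_mul_le_mul_right ?_ hp
  calc (1 - ‖x‖ ^ 2) / ‖1 - inner ℂ (xs n) x‖ ^ 2 * (1 - ‖xs n‖ ^ 2) = sigma (xs n) x := by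
        rw [sigma]; ring
    _ ≤ sigma (ys n) (ws n) := hσ n
    _ = (1 - ‖ws n‖ ^ 2) / ‖1 - inner ℂ (ys n) (ws n)‖ ^ 2 * (1 - ‖ys n‖ ^ 2) := by
        rw [sigma]; ring
    _ ≤ (1 - ‖ws n‖ ^ 2) / ‖1 - inner ℂ (ys n) (ws n)‖ ^ 2 * (β n * (1 - ‖xs n‖ ^ 2)) := by
        gcongr
        exact hratio n
    _ = _ := by ring

/-! ### A fixed point free map has a sink point -/

/-- If two points are dilated by factors larger than `1` without increasing their pseudo-hyperbolic
distance, then their distance is controlled by the difference of their norms. -/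
lemma norm_sub_sq_le_abs_of_sigma_le {x y : H} {a b : ℝ} (ha : 1 < a) (hb : 1 < b)
    (hx : ‖(a : ℂ) • x‖ < 1) (hy : ‖(b : ℂ) • y‖ < 1)
    (h : sigma x y ≤ sigma ((a : ℂ) • x) ((b : ℂ) • y)) :
    ‖x - y‖ ^ 2 ≤ |‖x‖ ^ 2 - ‖y‖ ^ 2| := by
  have ha0 : 0 < a := by linarith
  have hb0 : 0 < b := by linarith
  have hx1 : ‖x‖ < 1 := by
    rw [norm_smul, Complex.norm_real, Real.norm_of_nonneg ha0.le] at hx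
    nlinarith [norm_nonneg x]
  have hy1 : ‖y‖ < 1 := by
    rw [norm_smul, Complex.norm_real, Real.norm_of_nonneg hb0.le] at hy
    nlinarith [norm_nonneg y]
  have hD := one_sub_ne_zero_of_norm_lt_one (norm_inner_lt_one hx1 hy1.le)
  have hE := norm_one_sub_pos (norm_inner_lt_one hx hy.le)
  have hU := one_sub_norm_sq_pos hx
  have hV := one_sub_norm_sq_pos hy
  have hA := one_sub_norm_sq_pos hx1
  have hB := one_sub_norm_sq_pos hy1
  have hxx : ‖(a : ℂ) • x‖ ^ 2 = a ^ 2 * ‖x‖ ^ 2 := by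
    rw [norm_smul, Complex.norm_real, Real.norm_of_nonneg ha0.le, mul_pow]
  have hyy : ‖(b : ℂ) • y‖ ^ 2 = b ^ 2 * ‖y‖ ^ 2 := by
    rw [norm_smul, Complex.norm_real, Real.norm_of_nonneg hb0.le, mul_pow]
  have hin : inner ℂ ((a : ℂ) • x) ((b : ℂ) • y) = ((a * b : ℝ) : ℂ) * inner ℂ x y := by
    rw [inner_smul_left, inner_smul_right, Complex.conj_ofReal]
    push_cast
    ring
  rw [sigma, sigma, hxx, hyy, hin] at h
  rw [hxx] at hU
  rw [hyy] at hV
  rw [hin] at hE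
  have hsub : ‖x - y‖ ^ 2 = ‖x‖ ^ 2 - 2 * (inner ℂ x y : ℂ).re + ‖y‖ ^ 2 :=
    norm_sub_sq (𝕜 := ℂ) x y
  set p : ℂ := inner ℂ x y
  set X := ‖x‖ ^ 2 with hX
  set Y := ‖y‖ ^ 2 with hY
  have hX0 : 0 ≤ X := sq_nonneg _
  have hY0 : 0 ≤ Y := sq_nonneg _
  have hDpos : 0 < ‖1 - p‖ := norm_pos_iff.mpr hD
  -- `q = Re 1 / (1 - p)` bounds the dilated denominator from below
  set q := ((1 - p)⁻¹).re with hq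
  have hab : 0 < a * b - 1 := by nlinarith
  have hquot : |1 - (a * b - 1) * (q - 1)| ≤ ‖1 - ((a * b : ℝ) : ℂ) * p‖ / ‖1 - p‖ := by
    have e : (1 - ((a * b : ℝ) : ℂ) * p) / (1 - p) =
        1 - ((a * b - 1 : ℝ) : ℂ) * ((1 - p)⁻¹ - 1) := by
      push_cast
      field_simp
      ring
    rw [← norm_div, e]
    refine le_trans (le_of_eq ?_) (Complex.abs_re_le_norm _)
    rw [Complex.sub_re, Complex.re_ofReal_mul, Complex.sub_re, Complex.one_re]
  have hUV : (‖1 - ((a * b : ℝ) : ℂ) * p‖ / ‖1 - p‖) ^ 2 ≤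
      (1 - a ^ 2 * X) / (1 - X) * ((1 - b ^ 2 * Y) / (1 - Y)) := by
    rw [div_le_div_iff₀ (by positivity) (by positivity)] at h
    rw [div_pow, div_mul_div_comm, div_le_div_iff₀ (by positivity) (by positivity)]
    linarith
  set A := 1 / (1 - X) with hAdef
  set B := 1 / (1 - Y) with hBdef
  have eU : (1 - a ^ 2 * X) / (1 - X) = 1 - (a ^ 2 - 1) * (A - 1) := by
    rw [hAdef]
    field_simp
    ring
  have eV : (1 - b ^ 2 * Y) / (1 - Y) = 1 - (b ^ 2 - 1) * (B - 1) := by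
    rw [hBdef]
    field_simp
    ring
  have hUp : 0 < (1 - a ^ 2 * X) / (1 - X) := div_pos hU hA
  have hVp : 0 < (1 - b ^ 2 * Y) / (1 - Y) := div_pos hV hB
  rw [eU] at hUp hUV
  rw [eV] at hVp hUV
  set U := (a ^ 2 - 1) * (A - 1) with hUdef
  set V := (b ^ 2 - 1) * (B - 1) with hVdef
  -- the arithmetic-geometric mean inequality
  have hAG : ‖1 - ((a * b : ℝ) : ℂ) * p‖ / ‖1 - p‖ ≤ 1 - (U + V) / 2 := by
    refine le_of_sq_le_sq ?_ (by linarith)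
    nlinarith [sq_nonneg (U - V)]
  have hmain : (U + V) / 2 ≤ (a * b - 1) * (q - 1) := by
    linarith [(le_abs_self _).trans (hquot.trans hAG)]
  -- hence `q ≥ 1 / (1 - M)` for the smaller squared norm `M`
  set M := min X Y with hM
  have hM0 : 0 ≤ M := le_min hX0 hY0
  have hM1 : 0 < 1 - M := by linarith [min_le_left X Y]
  have hCA : 1 / (1 - M) ≤ A := by
    rw [hAdef]
    gcongr
    exact min_le_left _ _
  have hCB : 1 / (1 - M) ≤ B := by
    rw [hBdef]
    gcongr
    exact min_le_right _ _
  have hC1 : 1 ≤ 1 / (1 - M) := by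
    rw [le_div_iff₀ hM1]
    linarith
  set C := 1 / (1 - M) with hC
  have hqC : C ≤ q := by
    have h1 : (a ^ 2 - 1) * (C - 1) ≤ U :=
      mul_le_mul_of_nonneg_left (by linarith) (sub_nonneg.mpr (one_le_pow₀ ha.le))
    have h2 : (b ^ 2 - 1) * (C - 1) ≤ V :=
      mul_le_mul_of_nonneg_left (by linarith) (sub_nonneg.mpr (one_le_pow₀ hb.le))
    have h4 : ((a ^ 2 - 1) * (C - 1) + (b ^ 2 - 1) * (C - 1)) / 2 =
        (a * b - 1) * (C - 1) + (a - b) ^ 2 * (C - 1) / 2 := by ring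
    have h5 := mul_nonneg (sq_nonneg (a - b)) (sub_nonneg.mpr hC1)
    have h3 : (a * b - 1) * (C - 1) ≤ (a * b - 1) * (q - 1) := by linarith
    linarith [le_of_mul_le_mul_left h3 hab]
  have hnorm : ‖1 - p‖ ≤ 1 - M := by
    have h1 : C ≤ ‖1 - p‖⁻¹ := by
      rw [← norm_inv]
      exact hqC.trans (Complex.re_le_norm _)
    rw [hC, ← one_div, div_le_div_iff₀ hM1 hDpos] at h1
    linarith
  have hre : M ≤ p.re := by
    have := (Complex.re_le_norm (1 - p)).trans hnorm
    rw [Complex.sub_re, Complex.one_re] at this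
    linarith
  rw [hsub]
  rcases le_total X Y with hXY | hXY
  · rw [hM, min_eq_left hXY] at hre
    rw [abs_of_nonpos (by linarith)]
    linarith
  · rw [hM, min_eq_right hXY] at hre
    rw [abs_of_nonneg (by linarith)]
    linarith

/-- A fixed point free holomorphic map of the ball into a horosphere `E(τ,m)` does not increase the
horosphere distance to `τ`. The fixed points `z_n` of `t_n F`, `t_n → 1`, have a convergent
subsequence, because their mutual distances are controlled by their norms; the limit would be a
fixed point if it were inside the ball, so it is `τ`, and the Schwarz-Pick inequality for `t_n F`
at `z_n` passes to the limit. -/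
theorem horoDist_map_le_of_fixedPoint_free [CompleteSpace H] {F : H → H}
    (hF : DifferentiableOn ℂ F (unitBall H)) {τ : H} (hτ : ‖τ‖ = 1) {m : ℝ}
    (hmaps : Set.MapsTo F (unitBall H) (ellipsoid τ m)) (hfree : ∀ z ∈ unitBall H, F z ≠ z)
    {x : H} (hx : ‖x‖ < 1) : horoDist (F x) τ ≤ horoDist x τ := by
  have hF1 : ∀ z, ‖z‖ < 1 → ‖F z‖ < 1 := fun z hz =>
    mem_ball_zero_iff.mp (hmaps (mem_ball_zero_iff.mpr hz)).1
  obtain ⟨t, -, ht, htlim⟩ := exists_seq_strictMono_tendsto' (zero_lt_one' ℝ)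
  have htF : ∀ n, ∀ z, ‖z‖ < 1 → ‖(t n : ℂ) • F z‖ ≤ t n := fun n z hz => by
    rw [norm_smul, Complex.norm_real, Real.norm_of_nonneg (ht n).1.le]
    exact mul_le_of_le_one_right (ht n).1.le (hF1 z hz).le
  have hdiff : ∀ n, DifferentiableOn ℂ (fun z => (t n : ℂ) • F z) (unitBall H) :=
    fun n => hF.const_smul _
  choose z hz1 hz using fun n => exists_fixedPoint_of_norm_le (ht n).2 (hdiff n) (htF n)
  have hFz : ∀ n, F (z n) = (((t n)⁻¹ : ℝ) : ℂ) • z n := fun n => by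
    conv_rhs => rw [← hz n]
    rw [smul_smul, ← Complex.ofReal_mul, inv_mul_cancel₀ (ht n).1.ne', Complex.ofReal_one, one_smul]
  have hzz : ∀ i j, ‖z i - z j‖ ^ 2 ≤ |‖z i‖ ^ 2 - ‖z j‖ ^ 2| := fun i j => by
    have := sigma_le_sigma_map hF (fun w hw => (hmaps hw).1) (hz1 i) (hz1 j)
    have hi := hF1 _ (hz1 i)
    have hj := hF1 _ (hz1 j)
    rw [hFz] at hi hj
    rw [hFz, hFz] at this
    exact norm_sub_sq_le_abs_of_sigma_le (one_lt_inv_iff₀.mpr (ht i)) (one_lt_inv_iff₀.mpr (ht j))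
      hi hj this
  obtain ⟨X, -, φ, hφ, hX⟩ := (isCompact_Icc (a := (0 : ℝ)) (b := 1)).tendsto_subseq
    (x := fun n => ‖z n‖ ^ 2)
    (fun n => ⟨sq_nonneg _, (one_sub_norm_sq_pos (hz1 n)).le |> sub_nonneg.mp⟩)
  have hcauchy : CauchySeq (z ∘ φ) := by
    refine Metric.cauchySeq_iff.mpr fun ε hε => ?_
    obtain ⟨N, hN⟩ := Metric.cauchySeq_iff.mp hX.cauchySeq (ε ^ 2) (by positivity)
    refine ⟨N, fun i hi j hj => ?_⟩
    have h1 := hN i hi j hj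
    rw [Real.dist_eq] at h1
    rw [dist_eq_norm]
    exact lt_of_pow_lt_pow_left₀ 2 hε.le ((hzz _ _).trans_lt h1)
  obtain ⟨w, hw⟩ := cauchySeq_tendsto_of_complete hcauchy
  have htφ : Tendsto (fun n => (t (φ n) : ℂ)) atTop (𝓝 1) := by
    have := (Complex.continuous_ofReal.tendsto 1).comp (htlim.comp hφ.tendsto_atTop)
    simpa [Function.comp_def] using this
  have hFlim : Tendsto (fun n => F (z (φ n))) atTop (𝓝 w) := by
    have := (htφ.inv₀ one_ne_zero).smul hw
    simpa [hFz] using this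
  have hw1 : ‖w‖ ≤ 1 := le_of_tendsto hw.norm (Eventually.of_forall fun n => (hz1 _).le)
  have hwτ : w = τ := by
    rcases hw1.lt_or_eq with hlt | heq
    · have hwb : w ∈ unitBall H := mem_ball_zero_iff.mpr hlt
      have hcont : ContinuousAt F w :=
        (hF.differentiableAt (Metric.isOpen_ball.mem_nhds hwb)).continuousAt
      exact absurd (tendsto_nhds_unique (hcont.tendsto.comp hw) hFlim) (hfree w hwb)
    · exact eq_of_tendsto_of_mem_ellipsoid hτ
        (Eventually.of_forall fun n => hmaps (mem_ball_zero_iff.mpr (hz1 (φ n)))) heq hFlim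
  rw [hwτ] at hw
  have hFx := hF1 x hx
  refine (inv_le_inv₀ (horoDist_pos hτ hx) (horoDist_pos hτ hFx)).mp ?_
  refine inv_horoDist_le_of_tendsto (xs := z ∘ φ) (ys := z ∘ φ)
    (ws := fun n => (t (φ n) : ℂ) • F x) (β := fun _ => 1) hτ hx hFx (fun n => hz1 _)
    (fun n => (htF _ x hx).trans_lt (ht _).2) hw hw ?_ tendsto_const_nhds (fun n => ?_)
    (fun n => by rw [one_mul])
  · simpa using htφ.smul_const (F x)
  · have := sigma_le_sigma_map (hdiff (φ n)) (fun v hv => mem_ball_zero_iff.mpr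
      ((htF _ v (mem_ball_zero_iff.mp hv)).trans_lt (ht _).2)) (hz1 (φ n)) hx
    rwa [hz] at this

/-! ### Iterates at a sink point -/

/-- The parabolic map with boundary fixed point `τ` that lowers `1 / horoDist · τ` by `2 δ`. In the
Siegel half-space model of the ball, where `1 - ⟨z,τ⟩ = 2 / (w + 1)`, it is the translation
`w ↦ w - 2 δ`. -/
def parabolic (τ : H) (δ : ℝ) (z : H) : H :=
  (1 - (δ : ℂ) * (1 - inner ℂ τ z))⁻¹ • (z - ((δ : ℂ) * (1 - inner ℂ τ z)) • τ)

lemma norm_one_sub_mul_sq_sub {τ : H} (hτ : ‖τ‖ = 1) (δ : ℝ) (z : H) :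
    ‖1 - (δ : ℂ) * (1 - inner ℂ τ z)‖ ^ 2 - ‖z - ((δ : ℂ) * (1 - inner ℂ τ z)) • τ‖ ^ 2 =
      1 - ‖z‖ ^ 2 - 2 * δ * ‖1 - inner ℂ τ z‖ ^ 2 := by
  rw [norm_sub_sq (𝕜 := ℂ) z, norm_smul, hτ, inner_smul_right, ← inner_conj_symm z τ]
  generalize inner ℂ τ z = p
  change _ - (_ - 2 * Complex.re _ + _) = _
  simp only [mul_one, ← Complex.normSq_eq_norm_sq, Complex.normSq_apply, Complex.sub_re,
    Complex.sub_im, Complex.mul_re, Complex.mul_im, Complex.one_re, Complex.one_im,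
    Complex.ofReal_re, Complex.ofReal_im, Complex.conj_re, Complex.conj_im]
  ring

lemma one_sub_norm_sq_sub_pos {τ z : H} {m : ℝ} (hm : 0 < m) (hz : z ∈ ellipsoid τ m) :
    0 < 1 - ‖z‖ ^ 2 - 2 * (1 / (2 * m)) * ‖1 - inner ℂ τ z‖ ^ 2 := by
  have hp := one_sub_norm_sq_pos (mem_ball_zero_iff.mp hz.1)
  have h := (div_lt_iff₀ hp).mp hz.2
  have e : 2 * (1 / (2 * m)) * ‖1 - inner ℂ τ z‖ ^ 2 = ‖1 - inner ℂ τ z‖ ^ 2 / m := by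
    field_simp
  rw [e, sub_pos, div_lt_iff₀ hm]
  linarith

lemma parabolic_denom_ne_zero {τ z : H} (hτ : ‖τ‖ = 1) {m : ℝ} (hm : 0 < m)
    (hz : z ∈ ellipsoid τ m) : 1 - ((1 / (2 * m) : ℝ) : ℂ) * (1 - inner ℂ τ z) ≠ 0 := by
  intro h0
  have h := norm_one_sub_mul_sq_sub hτ (1 / (2 * m)) z
  have := one_sub_norm_sq_sub_pos hm hz
  rw [h0, norm_zero] at h
  nlinarith [sq_nonneg ‖z - (((1 / (2 * m) : ℝ) : ℂ) * (1 - inner ℂ τ z)) • τ‖]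

lemma one_sub_norm_parabolic_sq {τ z : H} (hτ : ‖τ‖ = 1) {m : ℝ} (hm : 0 < m)
    (hz : z ∈ ellipsoid τ m) :
    1 - ‖parabolic τ (1 / (2 * m)) z‖ ^ 2 =
      (1 - ‖z‖ ^ 2 - 2 * (1 / (2 * m)) * ‖1 - inner ℂ τ z‖ ^ 2) /
        ‖1 - ((1 / (2 * m) : ℝ) : ℂ) * (1 - inner ℂ τ z)‖ ^ 2 := by
  have hD := norm_pos_iff.mpr (parabolic_denom_ne_zero hτ hm hz)
  rw [← norm_one_sub_mul_sq_sub hτ (1 / (2 * m)) z, parabolic, norm_smul, norm_inv, mul_pow]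
  field_simp

lemma norm_parabolic_lt_one {τ z : H} (hτ : ‖τ‖ = 1) {m : ℝ} (hm : 0 < m)
    (hz : z ∈ ellipsoid τ m) : ‖parabolic τ (1 / (2 * m)) z‖ < 1 := by
  have h := one_sub_norm_parabolic_sq hτ hm hz
  have hD := norm_pos_iff.mpr (parabolic_denom_ne_zero hτ hm hz)
  have h1 : 0 < 1 - ‖parabolic τ (1 / (2 * m)) z‖ ^ 2 := by
    rw [h]
    exact div_pos (one_sub_norm_sq_sub_pos hm hz) (by positivity)
  by_contra! hc
  nlinarith

lemma inv_horoDist_parabolic {τ z : H} (hτ : ‖τ‖ = 1) {m : ℝ} (hm : 0 < m)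
    (hz : z ∈ ellipsoid τ m) :
    (horoDist (parabolic τ (1 / (2 * m)) z) τ)⁻¹ = (horoDist z τ)⁻¹ - 1 / m := by
  have hD := parabolic_denom_ne_zero hτ hm hz
  have hq := norm_one_sub_pos (norm_inner_lt_one' hτ.le (mem_ball_zero_iff.mp hz.1))
  have e : 1 - inner ℂ τ (parabolic τ (1 / (2 * m)) z) =
      (1 - inner ℂ τ z) / (1 - ((1 / (2 * m) : ℝ) : ℂ) * (1 - inner ℂ τ z)) := by
    rw [parabolic, inner_smul_right, inner_sub_right, inner_smul_right,
      (inner_eq_one_iff_of_norm_eq_one hτ hτ).mpr rfl]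
    field_simp
    ring
  rw [horoDist, horoDist, inv_div, inv_div, one_sub_norm_parabolic_sq hτ hm hz, e, norm_div]
  have hDn := norm_pos_iff.mpr hD
  set D := ‖1 - ((1 / (2 * m) : ℝ) : ℂ) * (1 - inner ℂ τ z)‖
  field_simp

lemma differentiableAt_parabolic {τ z : H} (hτ : ‖τ‖ = 1) {m : ℝ} (hm : 0 < m)
    (hz : z ∈ ellipsoid τ m) : DifferentiableAt ℂ (parabolic τ (1 / (2 * m))) z := by
  have hD := parabolic_denom_ne_zero hτ hm hz
  have hin : DifferentiableAt ℂ (fun w : H => inner ℂ τ w) z :=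
    (innerSL ℂ τ).differentiableAt
  have hq := (hin.const_sub 1).const_mul ((1 / (2 * m) : ℝ) : ℂ)
  simp only [funext fun w => parabolic.eq_1 τ (1 / (2 * m)) w]
  exact ((hq.const_sub 1).inv hD).smul (differentiableAt_id.sub (hq.smul_const τ))

lemma inv_horoDist_le {τ z : H} (hτ : ‖τ‖ = 1) (hz : ‖z‖ < 1) :
    (horoDist z τ)⁻¹ ≤ 2 / (1 - ‖z‖) - 1 := by
  have h1 := one_sub_norm_sq_pos hz
  have h2 := norm_one_sub_pos (norm_inner_lt_one' hτ.le hz)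
  have h3 : 1 - ‖z‖ ≤ ‖1 - inner ℂ τ z‖ := by
    have h4 := norm_inner_le_norm (𝕜 := ℂ) τ z
    have h5 := norm_sub_norm_le (1 : ℂ) (inner ℂ τ z)
    rw [hτ, one_mul] at h4
    rw [norm_one] at h5
    linarith
  have h0 : 0 < 1 - ‖z‖ := by linarith
  have e : 2 / (1 - ‖z‖) - 1 = (1 - ‖z‖ ^ 2) / (1 - ‖z‖) ^ 2 := by
    field_simp
    ring
  rw [horoDist, inv_div, e]
  gcongr

lemma inv_horoDist_ofReal_smul {τ : H} (hτ : ‖τ‖ = 1) {r : ℝ} (hr : r < 1) :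
    (horoDist ((r : ℂ) • τ) τ)⁻¹ = 2 / (1 - r) - 1 := by
  have h0 : 1 - r ≠ 0 := by linarith
  rw [horoDist, inv_div, inner_smul_right, (inner_eq_one_iff_of_norm_eq_one hτ hτ).mpr rfl,
    mul_one, ← Complex.ofReal_one, ← Complex.ofReal_sub, norm_smul, hτ, mul_one, Complex.norm_real,
    Complex.norm_real, Real.norm_eq_abs, Real.norm_eq_abs, sq_abs, sq_abs]
  field_simp
  ring

/-- If a map into the horosphere `E(τ,m)` has `τ` as a sink point, then it lowers the horosphere
distance by a definite amount. Indeed the composition `P ∘ F` with the parabolic map `P` of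
`E(τ,m)` onto the ball has at `τ` radially the same dilation as `F`, which is at most `1`; so
`P ∘ F` does not increase the horosphere distance either. -/
lemma inv_horoDist_map_ge {F : H → H} (hF : DifferentiableOn ℂ F (unitBall H)) {τ : H}
    (hτ : ‖τ‖ = 1) {m : ℝ} (hm : 0 < m) (hmaps : Set.MapsTo F (unitBall H) (ellipsoid τ m))
    (hsink : ∀ z, ‖z‖ < 1 → horoDist (F z) τ ≤ horoDist z τ) {x : H} (hx : ‖x‖ < 1) :
    (horoDist x τ)⁻¹ + 1 / m ≤ (horoDist (F x) τ)⁻¹ := by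
  set P := parabolic τ (1 / (2 * m))
  have hFm : ∀ z, ‖z‖ < 1 → F z ∈ ellipsoid τ m := fun z hz => hmaps (mem_ball_zero_iff.mpr hz)
  have hP1 : ∀ z, ‖z‖ < 1 → ‖P (F z)‖ < 1 := fun z hz => norm_parabolic_lt_one hτ hm (hFm z hz)
  have hPF : DifferentiableOn ℂ (P ∘ F) (unitBall H) := fun z hz =>
    (differentiableAt_parabolic hτ hm (hmaps hz)).comp_differentiableWithinAt z (hF z hz)
  suffices h : (horoDist x τ)⁻¹ ≤ (horoDist (P (F x)) τ)⁻¹ by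
    rw [inv_horoDist_parabolic hτ hm (hFm x hx)] at h
    linarith
  -- radii with `1 - r < m`, so that `1 / horoDist (P (F (r τ))) τ` is bounded below by
  -- `2 / (1 - r) - 1 - 1 / m > 0`
  obtain ⟨r, -, hr, hrlim⟩ := exists_seq_strictMono_tendsto' (max_lt zero_lt_one (sub_lt_self 1 hm))
  have hr0 : ∀ n, 0 < r n := fun n => (le_max_left _ _).trans_lt (hr n).1
  have hr1 : ∀ n, r n < 1 := fun n => (hr n).2
  have hrm : ∀ n, 1 / m * (1 - r n) < 1 := fun n => by
    have := (le_max_right _ _).trans_lt (hr n).1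
    rw [one_div_mul_eq_div, div_lt_one hm]
    linarith
  set c := 1 / m
  have hnorm : ∀ n, ‖(r n : ℂ) • τ‖ = r n := fun n => by
    rw [norm_smul, hτ, mul_one, Complex.norm_real, Real.norm_of_nonneg (hr0 n).le]
  have hxs1 : ∀ n, ‖(r n : ℂ) • τ‖ < 1 := fun n => (hnorm n).trans_lt (hr1 n)
  have hxs : Tendsto (fun n => (r n : ℂ) • τ) atTop (𝓝 τ) := by
    have := ((Complex.continuous_ofReal.tendsto 1).comp hrlim).smul_const τ
    simpa [Function.comp_def] using this
  have hlow : ∀ n, 2 / (1 - r n) - 1 - c ≤ (horoDist (P (F ((r n : ℂ) • τ))) τ)⁻¹ := fun n => by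
    rw [inv_horoDist_parabolic hτ hm (hFm _ (hxs1 n)), ← inv_horoDist_ofReal_smul hτ (hr1 n)]
    have := (inv_le_inv₀ (horoDist_pos hτ (hxs1 n))
      (horoDist_pos hτ (mem_ball_zero_iff.mp (hFm _ (hxs1 n)).1))).mpr (hsink _ (hxs1 n))
    linarith
  have hpos : ∀ n, 0 < 2 / (1 - r n) - 1 - c := fun n => by
    have h1 : 0 < 1 - r n := by linarith [hr1 n]
    have e : 2 / (1 - r n) - 1 - c = (1 + r n - c * (1 - r n)) / (1 - r n) := by
      field_simp
      ring
    rw [e]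
    exact div_pos (by linarith [hr0 n, hrm n]) h1
  have hys : Tendsto (fun n => P (F ((r n : ℂ) • τ))) atTop (𝓝 τ) := by
    have hdiv : Tendsto (fun n => 4 * (2 / (1 - r n) - 1 - c)⁻¹) atTop (𝓝 0) := by
      have h1 : Tendsto (fun n => (1 - r n)) atTop (𝓝[>] 0) :=
        tendsto_nhdsWithin_iff.mpr ⟨by simpa using hrlim.const_sub 1,
          Eventually.of_forall fun n => sub_pos.mpr (hr1 n)⟩
      have h2 : Tendsto (fun n => 2 / (1 - r n) - 1 - c) atTop atTop := by
        simp only [div_eq_mul_inv, sub_sub]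
        exact tendsto_atTop_add_const_right _ _
          ((tendsto_inv_nhdsGT_zero.comp h1).const_mul_atTop two_pos)
      simpa using (tendsto_inv_atTop_zero.comp h2).const_mul 4
    rw [tendsto_iff_norm_sub_tendsto_zero]
    have h4 : Tendsto (fun n => ‖P (F ((r n : ℂ) • τ)) - τ‖ ^ 4) atTop (𝓝 0) := by
      refine squeeze_zero (fun n => by positivity) (fun n => ?_) hdiv
      refine (norm_sub_pow_four_le_horoDist hτ (hP1 _ (hxs1 n))).trans ?_
      have := (le_inv_comm₀ (hpos n) (horoDist_pos hτ (hP1 _ (hxs1 n)))).mp (hlow n)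
      linarith
    have h5 := (Real.continuous_sqrt.tendsto _).comp ((Real.continuous_sqrt.tendsto _).comp h4)
    rw [Real.sqrt_zero, Real.sqrt_zero] at h5
    refine h5.congr fun n => ?_
    simp only [Function.comp_apply]
    rw [show ‖P (F ((r n : ℂ) • τ)) - τ‖ ^ 4 = (‖P (F ((r n : ℂ) • τ)) - τ‖ ^ 2) ^ 2 by ring,
      Real.sqrt_sq (sq_nonneg _), Real.sqrt_sq (norm_nonneg _)]
  refine inv_horoDist_le_of_tendsto (xs := fun n => (r n : ℂ) • τ)
    (ys := fun n => P (F ((r n : ℂ) • τ))) (ws := fun _ => P (F x))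
    (β := fun n => 4 / ((2 - c * (1 - r n)) * (1 + r n))) hτ hx (hP1 x hx) hxs1
    (fun _ => hP1 x hx) hxs hys tendsto_const_nhds ?_
    (fun n => sigma_le_sigma_map hPF (fun z hz => mem_ball_zero_iff.mpr
      (hP1 z (mem_ball_zero_iff.mp hz))) (hxs1 n) hx) (fun n => ?_)
  · have : Tendsto (fun n => 4 / ((2 - c * (1 - r n)) * (1 + r n))) atTop
        (𝓝 (4 / ((2 - c * (1 - 1)) * (1 + 1)))) :=
      tendsto_const_nhds.div ((((hrlim.const_sub 1).const_mul c).const_sub 2).mul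
        (hrlim.const_add 1)) (by norm_num)
    convert this using 2
    norm_num
  · have hy1 := hP1 _ (hxs1 n)
    have h1 := (hlow n).trans (inv_horoDist_le hτ hy1)
    rw [hnorm n]
    set ρ := ‖P (F ((r n : ℂ) • τ))‖
    have hρ0 : 0 ≤ ρ := norm_nonneg _
    have hr' : 0 < 1 - r n := by linarith [hr1 n]
    have hρ' : 0 < 1 - ρ := by linarith
    have hc2 : 0 < 2 - c * (1 - r n) := by linarith [hrm n]
    have h2 : (1 - ρ) * (2 - c * (1 - r n)) ≤ 2 * (1 - r n) := by
      have h3 : (2 - c * (1 - r n)) / (1 - r n) ≤ 2 / (1 - ρ) := by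
        have e : (2 - c * (1 - r n)) / (1 - r n) = 2 / (1 - r n) - c := by field_simp
        rw [e]
        linarith
      rw [div_le_div_iff₀ hr' hρ'] at h3
      linarith
    have hr1' : 0 < 1 + r n := by linarith [hr0 n]
    have e : 4 / ((2 - c * (1 - r n)) * (1 + r n)) * (1 - r n ^ 2) =
        4 * (1 - r n) / (2 - c * (1 - r n)) := by
      field_simp
      ring
    rw [e, le_div_iff₀ hc2]
    nlinarith

lemma horoDist_map_le_of_isSinkPoint {F : H → H} {τ : H} (hs : IsSinkPoint F τ) {z : H}
    (hz : ‖z‖ < 1) : horoDist (F z) τ ≤ horoDist z τ := by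
  refine le_of_forall_gt fun k hk => ?_
  exact (hs.2 k ((horoDist_pos hs.1 hz).trans hk) ⟨mem_ball_zero_iff.mpr hz, hk⟩).2

/-- If a map into the horosphere `E(τ,m)` has `τ` as a sink point, then its iterates converge to
`τ`, even uniformly on the whole ball. -/
theorem tendstoUniformlyOn_iterate_of_isSinkPoint {F : H → H}
    (hF : DifferentiableOn ℂ F (unitBall H)) {τ : H} {m : ℝ} (hm : 0 < m)
    (hmaps : Set.MapsTo F (unitBall H) (ellipsoid τ m)) (hs : IsSinkPoint F τ) :
    TendstoUniformlyOn (fun n => F^[n]) (fun _ => τ) atTop (unitBall H) := by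
  have hτ := hs.1
  have hit : ∀ n, ∀ z, ‖z‖ < 1 → ‖F^[n] z‖ < 1 ∧ n / m ≤ (horoDist (F^[n] z) τ)⁻¹ := by
    intro n z hz
    induction n with
    | zero => simpa [hz] using (horoDist_pos hτ hz).le
    | succ n ih =>
      rw [Function.iterate_succ_apply']
      have h1 := hmaps (mem_ball_zero_iff.mpr ih.1)
      have h2 := inv_horoDist_map_ge hF hτ hm hmaps
        (fun z hz => horoDist_map_le_of_isSinkPoint hs hz) ih.1
      refine ⟨mem_ball_zero_iff.mp h1.1, ?_⟩
      push_cast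
      rw [add_div]
      linarith [ih.2]
  rw [Metric.tendstoUniformlyOn_iff]
  intro ε hε
  obtain ⟨N, hN⟩ := exists_nat_gt (4 * m / ε ^ 4)
  filter_upwards [eventually_ge_atTop N, eventually_gt_atTop 0] with n hn hn0 z hz
  obtain ⟨h1, h2⟩ := hit n z (mem_ball_zero_iff.mp hz)
  have hn' : (0 : ℝ) < n := Nat.cast_pos.mpr hn0
  rw [dist_comm, dist_eq_norm]
  refine lt_of_pow_lt_pow_left₀ 4 hε.le ((norm_sub_pow_four_le_horoDist hτ h1).trans_lt ?_)
  have h3 := (le_inv_comm₀ (div_pos hn' hm) (horoDist_pos hτ h1)).mp h2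
  rw [inv_div] at h3
  have h4 : 4 * m / ε ^ 4 < n := hN.trans_le (Nat.cast_le.mpr hn)
  rw [div_lt_iff₀ (by positivity)] at h4
  have h5 : 4 * (m / n) < ε ^ 4 := by
    rw [← mul_div_assoc, div_lt_iff₀ hn']
    linarith
  linarith

/-! ### Maps with a fixed point at the origin -/

lemma differentiableOn_comp_smul {Φ : H → H} (hΦ : DifferentiableOn ℂ Φ (unitBall H)) {e : H}
    (he : ‖e‖ = 1) : DifferentiableOn ℂ (fun l : ℂ => Φ (l • e)) (Metric.ball 0 1) :=
  hΦ.comp (differentiable_id.smul_const e).differentiableOn fun l hl => by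
    rw [mem_ball_zero_iff] at hl ⊢
    simpa [norm_smul, he] using hl

lemma mapsTo_comp_smul {Φ : H → H} (hmaps : Set.MapsTo Φ (unitBall H) (unitBall H))
    (h0 : Φ 0 = 0) {e : H} (he : ‖e‖ = 1) :
    Set.MapsTo (fun l : ℂ => Φ (l • e)) (Metric.ball 0 1)
      (Metric.closedBall (Φ ((0 : ℂ) • e)) 1) := fun l hl => by
  rw [zero_smul, h0]
  refine Metric.ball_subset_closedBall (hmaps ?_)
  rw [mem_ball_zero_iff] at hl ⊢
  simpa [norm_smul, he] using hl

lemma deriv_comp_smul {Φ : H → H} (hΦ : DifferentiableOn ℂ Φ (unitBall H)) (e : H) :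
    deriv (fun l : ℂ => Φ (l • e)) 0 = fderiv ℂ Φ 0 e := by
  have h1 : HasFDerivAt Φ (fderiv ℂ Φ 0) ((0 : ℂ) • e) := by
    rw [zero_smul]
    exact (hΦ.differentiableAt (Metric.ball_mem_nhds _ one_pos)).hasFDerivAt
  have h2 : HasDerivAt (fun l : ℂ => l • e) e 0 := by
    simpa using (hasDerivAt_id (0 : ℂ)).smul_const e
  exact (h1.comp_hasDerivAt (0 : ℂ) h2).deriv

lemma norm_dslope_comp_smul {Φ : H → H} (h0 : Φ 0 = 0) {x : H} (hx : x ≠ 0) :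
    ‖dslope (fun l : ℂ => Φ (l • ((‖x‖⁻¹ : ℝ) : ℂ) • x)) 0 (‖x‖ : ℂ)‖ = ‖Φ x‖ / ‖x‖ := by
  have hx' : (‖x‖ : ℂ) ≠ 0 := Complex.ofReal_ne_zero.mpr (norm_ne_zero_iff.mpr hx)
  rw [dslope_of_ne _ hx', slope_def_module, zero_smul, h0, sub_zero, sub_zero, smul_smul,
    Complex.ofReal_inv, mul_inv_cancel₀ hx', one_smul, norm_smul, norm_inv, Complex.norm_real,
    norm_norm, div_eq_inv_mul]

lemma norm_inv_norm_smul {x : H} (hx : x ≠ 0) : ‖((‖x‖⁻¹ : ℝ) : ℂ) • x‖ = 1 := by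
  rw [norm_smul, Complex.norm_real, norm_inv, norm_norm,
    inv_mul_cancel₀ (norm_ne_zero_iff.mpr hx)]

/-- A quantitative Schwarz lemma: if the derivative at the fixed point `0` has norm at most `q < 1`,
the map contracts the norm by a fixed factor on each smaller ball. This is the Schwarz-Pick
inequality for the slope `l ↦ Φ (l e) / l`, which maps the disc into the closed ball. -/
lemma norm_map_le_of_norm_fderiv_le [CompleteSpace H] {Φ : H → H}
    (hΦ : DifferentiableOn ℂ Φ (unitBall H))
    (hmaps : Set.MapsTo Φ (unitBall H) (unitBall H)) (h0 : Φ 0 = 0) {q s : ℝ} (hq1 : q < 1)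
    (hq : ‖fderiv ℂ Φ 0‖ ≤ q) (hs : 0 < s) {x : H} (hxs : ‖x‖ ^ 2 ≤ 1 - s) :
    ‖Φ x‖ ≤ √(1 - s * (1 - q) ^ 2) * ‖x‖ := by
  rcases eq_or_ne x 0 with rfl | hx
  · simp [h0]
  have hx1 : ‖x‖ < 1 := by nlinarith [norm_nonneg x]
  have he := norm_inv_norm_smul hx
  set e := ((‖x‖⁻¹ : ℝ) : ℂ) • x with hedef
  set K := dslope (fun l : ℂ => Φ (l • e)) 0 with hK
  have hKd : DifferentiableOn ℂ K (Metric.ball 0 1) :=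
    (Complex.differentiableOn_dslope (Metric.ball_mem_nhds _ one_pos)).mpr
      (differentiableOn_comp_smul hΦ he)
  have hK1 : ∀ l ∈ Metric.ball (0 : ℂ) 1, ‖K l‖ ≤ 1 := fun l hl => by
    simpa using Complex.norm_dslope_le_div_of_mapsTo_ball (differentiableOn_comp_smul hΦ he)
      (mapsTo_comp_smul hmaps h0 he) hl
  have hK0 : ‖K 0‖ ≤ q := by
    rw [hK, dslope_same, deriv_comp_smul hΦ]
    exact ((fderiv ℂ Φ 0).le_opNorm e).trans (by rwa [he, mul_one])
  have hxl : ‖(‖x‖ : ℂ)‖ < 1 := by simpa using hx1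
  have hKx := hK1 _ (mem_ball_zero_iff.mpr hxl)
  have hKxe : ‖K (‖x‖ : ℂ)‖ = ‖Φ x‖ / ‖x‖ := norm_dslope_comp_smul h0 hx
  -- the strict contractions `c K`, `c < 1`, map the disc into the open ball
  have hc : ∀ c ∈ Set.Ioo (0 : ℝ) 1, c ^ 2 * ‖K (‖x‖ : ℂ)‖ ^ 2 ≤ 1 - s * (1 - q) ^ 2 := by
    intro c hc
    have hn : ∀ l, ‖(c : ℂ) • K l‖ = c * ‖K l‖ := fun l => by
      rw [norm_smul, Complex.norm_real, Real.norm_of_nonneg hc.1.le]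
    have hcK : Set.MapsTo (fun l => (c : ℂ) • K l) (unitBall ℂ) (unitBall H) := fun l hl => by
      rw [mem_ball_zero_iff, hn]
      nlinarith [hK1 l hl, hc.1, hc.2]
    have hsp := sigma_le_sigma_map (hKd.const_smul (c : ℂ)) hcK (x := 0) (by simp) hxl
    have h00 : ‖(c : ℂ) • K 0‖ ≤ q := by
      rw [hn]
      exact (mul_le_of_le_one_left (norm_nonneg _) hc.2.le).trans hK0
    have h11 : ‖(c : ℂ) • K (‖x‖ : ℂ)‖ < 1 := mem_ball_zero_iff.mp (hcK (mem_ball_zero_iff.mpr hxl))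
    have hden : 1 - q ≤ ‖1 - inner ℂ ((c : ℂ) • K 0) ((c : ℂ) • K (‖x‖ : ℂ))‖ := by
      have h4 := norm_inner_le_norm (𝕜 := ℂ) ((c : ℂ) • K 0) ((c : ℂ) • K (‖x‖ : ℂ))
      have h5 := norm_sub_norm_le (1 : ℂ) (inner ℂ ((c : ℂ) • K 0) ((c : ℂ) • K (‖x‖ : ℂ)))
      rw [norm_one] at h5
      nlinarith [norm_nonneg ((c : ℂ) • K 0)]
    have hq' : 0 < 1 - q := by linarith
    have hpos := one_sub_norm_sq_pos h11
    have hle : sigma ((c : ℂ) • K 0) ((c : ℂ) • K (‖x‖ : ℂ)) ≤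
        1 * (1 - ‖(c : ℂ) • K (‖x‖ : ℂ)‖ ^ 2) / (1 - q) ^ 2 := by
      rw [sigma]
      gcongr
      linarith [sq_nonneg ‖(c : ℂ) • K 0‖]
    have h6 : sigma (0 : ℂ) (‖x‖ : ℂ) = 1 - ‖x‖ ^ 2 := by simp [sigma]
    rw [h6] at hsp
    have h7 := hsp.trans hle
    rw [one_mul, le_div_iff₀ (by positivity), hn, mul_pow] at h7
    nlinarith [mul_le_mul_of_nonneg_right hxs (sq_nonneg (1 - q))]
  have hlim : ‖K (‖x‖ : ℂ)‖ ^ 2 ≤ 1 - s * (1 - q) ^ 2 := by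
    have ht : Tendsto (fun c : ℝ => c ^ 2 * ‖K (‖x‖ : ℂ)‖ ^ 2) (𝓝[<] 1)
        (𝓝 (1 ^ 2 * ‖K (‖x‖ : ℂ)‖ ^ 2)) :=
      Tendsto.mono_left (Continuous.tendsto (by fun_prop) 1) nhdsWithin_le_nhds
    rw [one_pow, one_mul] at ht
    refine le_of_tendsto ht ?_
    filter_upwards [Ioo_mem_nhdsLT (zero_lt_one' ℝ)] with c hc' using hc c hc'
  have := Real.le_sqrt_of_sq_le hlim
  rwa [hKxe, div_le_iff₀ (norm_pos_iff.mpr hx)] at this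

/-- The spectral radius is the exponential growth rate of the powers. -/
lemma exists_norm_pow_lt_one {A : Type*} [NormedRing A] [NormedAlgebra ℂ A] [CompleteSpace A]
    {a : A} (h : spectralRadius ℂ a < 1) : ∃ N, 0 < N ∧ ‖a ^ N‖ < 1 := by
  have h1 := (spectrum.pow_nnnorm_pow_one_div_tendsto_nhds_spectralRadius a).eventually_lt_const h
  obtain ⟨N, hN, hN0⟩ := (h1.and (eventually_gt_atTop 0)).exists
  refine ⟨N, hN0, ?_⟩
  have h2 : ((‖a ^ N‖₊ : ENNReal)) < 1 := by
    by_contra! hc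
    exact absurd hN (not_lt.mpr (ENNReal.one_le_rpow hc (by positivity)))
  exact_mod_cast h2

/-! ### Maps with an interior fixed point -/

/-- The conjugate of a self-map of the ball by the automorphism that moves `ζ` to the origin. -/
def recenter (F : H → H) (ζ : H) : H → H := mobius ζ ∘ F ∘ mobius ζ

section Recenter

variable {F : H → H} {ζ : H}

lemma mapsTo_recenter (hmaps : Set.MapsTo F (unitBall H) (unitBall H)) (hζ : ‖ζ‖ < 1) :
    Set.MapsTo (recenter F ζ) (unitBall H) (unitBall H) :=
  (mapsTo_mobius hζ).comp (hmaps.comp (mapsTo_mobius hζ))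

lemma differentiableOn_recenter (hF : DifferentiableOn ℂ F (unitBall H))
    (hmaps : Set.MapsTo F (unitBall H) (unitBall H)) (hζ : ‖ζ‖ < 1) :
    DifferentiableOn ℂ (recenter F ζ) (unitBall H) :=
  (differentiableOn_mobius hζ).comp (hF.comp (differentiableOn_mobius hζ) (mapsTo_mobius hζ))
    (hmaps.comp (mapsTo_mobius hζ))

lemma recenter_zero (hζ : ‖ζ‖ < 1) (hfix : F ζ = ζ) : recenter F ζ 0 = 0 := by
  simp [recenter, hfix, mobius_self hζ]

lemma mobius_recenter (hmaps : Set.MapsTo F (unitBall H) (unitBall H)) (hζ : ‖ζ‖ < 1) {x : H}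
    (hx : ‖x‖ < 1) : mobius ζ (recenter F ζ x) = F (mobius ζ x) :=
  mobius_mobius hζ (mem_ball_zero_iff.mp
    (hmaps (mapsTo_mobius hζ (mem_ball_zero_iff.mpr hx)))).le

lemma iterate_eq_mobius_recenter (hmaps : Set.MapsTo F (unitBall H) (unitBall H)) (hζ : ‖ζ‖ < 1)
    {z : H} (hz : ‖z‖ < 1) (n : ℕ) :
    F^[n] z = mobius ζ ((recenter F ζ)^[n] (mobius ζ z)) := by
  induction n with
  | zero => simp [mobius_mobius hζ hz.le]
  | succ n ih =>
    have h1 := (mapsTo_recenter hmaps hζ).iterate n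
      (mapsTo_mobius hζ (mem_ball_zero_iff.mpr hz))
    rw [Function.iterate_succ_apply', Function.iterate_succ_apply', ih,
      mobius_recenter hmaps hζ (mem_ball_zero_iff.mp h1)]

/-- A map into a horosphere is not an isometry on any complex line through a fixed point: at the
boundary of the corresponding disc its values could accumulate only at `τ`. -/
lemma not_forall_recenter_smul_eq {τ : H} (hτ : ‖τ‖ = 1) {m : ℝ}
    (hmaps : Set.MapsTo F (unitBall H) (ellipsoid τ m)) (hζ : ‖ζ‖ < 1) {e v : H} (he : ‖e‖ = 1)
    (hv : ‖v‖ = 1) : ¬ ∀ l : ℂ, ‖l‖ < 1 → recenter F ζ (l • e) = l • v := by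
  intro h
  have key : ∀ c : ℂ, ‖c‖ = 1 → mobius ζ (c • v) = τ := by
    intro c hc
    have hcv : ‖c • v‖ = 1 := by rw [norm_smul, hc, hv, mul_one]
    have hlim : Tendsto (fun r : ℝ => ((r : ℂ) * c) • v) (𝓝[<] 1) (𝓝 (c • v)) := by
      have : Tendsto (fun r : ℝ => ((r : ℂ) * c) • v) (𝓝 1) (𝓝 ((((1 : ℝ) : ℂ) * c) • v)) :=
        Continuous.tendsto (by fun_prop) 1
      rw [Complex.ofReal_one, one_mul] at this
      exact this.mono_left nhdsWithin_le_nhds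
    refine eq_of_tendsto_of_mem_ellipsoid (m := m) hτ ?_ (norm_mobius_eq_one hζ hcv)
      ((differentiableAt_mobius hζ hcv.le).continuousAt.tendsto.comp hlim)
    filter_upwards [Ioo_mem_nhdsLT (zero_lt_one' ℝ)] with r hr
    have hrc : ‖(r : ℂ) * c‖ < 1 := by
      rw [norm_mul, hc, mul_one, Complex.norm_real, Real.norm_of_nonneg hr.1.le]
      exact hr.2
    have hre : ‖((r : ℂ) * c) • e‖ < 1 := by rwa [norm_smul, he, mul_one]
    rw [Function.comp_apply, ← h _ hrc, mobius_recenter (fun z hz => (hmaps hz).1) hζ hre]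
    exact hmaps (mapsTo_mobius hζ (mem_ball_zero_iff.mpr hre))
  have h1 := key 1 norm_one
  have h2 := key (-1) (by simp)
  rw [one_smul] at h1
  rw [neg_one_smul] at h2
  have h3 : v = -v := (mobius_mobius hζ hv.le).symm.trans (by
    rw [h1, ← h2]
    exact mobius_mobius hζ (by rw [norm_neg, hv]))
  have h4 : v = 0 := by
    have : (2 : ℂ) • v = 0 := by
      rw [two_smul]
      exact add_eq_zero_iff_eq_neg.mpr h3
    exact (smul_eq_zero.mp this).resolve_left two_ne_zero
  rw [h4, norm_zero] at hv
  exact zero_ne_one hv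

/-- The Schwarz lemma is strict for the recentered map: by the equality case, the map would
otherwise be linear and isometric on a complex line. -/
lemma norm_dslope_recenter_lt_one (hF : DifferentiableOn ℂ F (unitBall H)) {τ : H} (hτ : ‖τ‖ = 1)
    {m : ℝ} (hmaps : Set.MapsTo F (unitBall H) (ellipsoid τ m)) (hζ : ‖ζ‖ < 1) (hfix : F ζ = ζ)
    {e : H} (he : ‖e‖ = 1) {l : ℂ} (hl : ‖l‖ < 1) :
    ‖dslope (fun l : ℂ => recenter F ζ (l • e)) 0 l‖ < 1 := by
  have hmaps' : Set.MapsTo F (unitBall H) (unitBall H) := fun z hz => (hmaps hz).1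
  have hd := differentiableOn_comp_smul (differentiableOn_recenter hF hmaps' hζ) he
  have hm := mapsTo_comp_smul (mapsTo_recenter hmaps' hζ) (recenter_zero hζ hfix) he
  have hlb : l ∈ Metric.ball (0 : ℂ) 1 := mem_ball_zero_iff.mpr hl
  have hle := Complex.norm_dslope_le_div_of_mapsTo_ball hd hm hlb
  rw [div_one] at hle
  refine lt_of_le_of_ne hle fun heq => ?_
  have : UniformConvexSpace H := by
    let _ := InnerProductSpace.rclikeToReal ℂ H
    infer_instance
  have haff := Complex.affine_of_mapsTo_ball_of_norm_dslope_eq_div hd hm hlb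
    (by rw [heq, div_one])
  refine not_forall_recenter_smul_eq hτ hmaps hζ he heq fun k hk => ?_
  have := haff (mem_ball_zero_iff.mpr hk)
  simpa [recenter_zero hζ hfix] using this

/-- A holomorphic map into a horosphere has at most one fixed point in the ball. -/
theorem eq_of_fixedPoints (hF : DifferentiableOn ℂ F (unitBall H)) {τ : H} (hτ : ‖τ‖ = 1)
    {m : ℝ} (hmaps : Set.MapsTo F (unitBall H) (ellipsoid τ m)) (hζ : ‖ζ‖ < 1) (hfix : F ζ = ζ)
    {w : H} (hw : ‖w‖ < 1) (hfixw : F w = w) : ζ = w := by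
  by_contra hne
  have hx0 : mobius ζ w ≠ 0 := by
    intro h
    have := mobius_mobius hζ hw.le
    rw [h, mobius_zero] at this
    exact hne this
  have hx1 := norm_mobius_lt_one hζ hw
  have hfx : recenter F ζ (mobius ζ w) = mobius ζ w := by
    simp [recenter, mobius_mobius hζ hw.le, hfixw]
  have h := norm_dslope_recenter_lt_one hF hτ hmaps hζ hfix (norm_inv_norm_smul hx0)
    (l := (‖mobius ζ w‖ : ℂ)) (by simpa using hx1)
  rw [norm_dslope_comp_smul (recenter_zero hζ hfix) hx0, hfx,
    div_self (norm_ne_zero_iff.mpr hx0)] at h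
  exact lt_irrefl _ h

/-- The derivative of the recentered map at the origin is similar to the derivative of the map at
its fixed point. -/
lemma exists_unit_fderiv_recenter (hF : DifferentiableOn ℂ F (unitBall H)) (hζ : ‖ζ‖ < 1)
    (hfix : F ζ = ζ) :
    ∃ u : (H →L[ℂ] H)ˣ, fderiv ℂ (recenter F ζ) 0 =
      (u : H →L[ℂ] H) * fderiv ℂ F ζ * ((u⁻¹ : (H →L[ℂ] H)ˣ) : H →L[ℂ] H) := by
  have hζb : ζ ∈ unitBall H := mem_ball_zero_iff.mpr hζ
  have h1 : HasFDerivAt (mobius ζ) (fderiv ℂ (mobius ζ) 0) 0 :=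
    (differentiableAt_mobius hζ (by simp)).hasFDerivAt
  have h2 : HasFDerivAt (mobius ζ) (fderiv ℂ (mobius ζ) ζ) ζ :=
    (differentiableAt_mobius hζ hζ.le).hasFDerivAt
  have hFd : HasFDerivAt F (fderiv ℂ F ζ) ζ :=
    (hF.differentiableAt (Metric.isOpen_ball.mem_nhds hζb)).hasFDerivAt
  have hid : ∀ z ∈ unitBall H, mobius ζ ∘ mobius ζ =ᶠ[𝓝 z] id := fun z hz => by
    filter_upwards [Metric.isOpen_ball.mem_nhds hz] with x hx
    exact mobius_mobius hζ (mem_ball_zero_iff.mp hx).le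
  have h2' : HasFDerivAt (mobius ζ) (fderiv ℂ (mobius ζ) ζ) (mobius ζ 0) := by
    rwa [mobius_zero]
  have h1' : HasFDerivAt (mobius ζ) (fderiv ℂ (mobius ζ) 0) (mobius ζ ζ) := by
    rwa [mobius_self hζ]
  have e21 : fderiv ℂ (mobius ζ) ζ * fderiv ℂ (mobius ζ) 0 = 1 :=
    (h2'.comp 0 h1).unique ((hasFDerivAt_id 0).congr_of_eventuallyEq
      (hid 0 (Metric.mem_ball_self one_pos)))
  have e12 : fderiv ℂ (mobius ζ) 0 * fderiv ℂ (mobius ζ) ζ = 1 :=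
    (h1'.comp ζ h2).unique ((hasFDerivAt_id ζ).congr_of_eventuallyEq (hid ζ hζb))
  refine ⟨⟨fderiv ℂ (mobius ζ) ζ, fderiv ℂ (mobius ζ) 0, e21, e12⟩, ?_⟩
  have hFd' : HasFDerivAt F (fderiv ℂ F ζ) (mobius ζ 0) := by rwa [mobius_zero]
  have h2F : HasFDerivAt (mobius ζ) (fderiv ℂ (mobius ζ) ζ) ((F ∘ mobius ζ) 0) := by
    rwa [Function.comp_apply, mobius_zero, hfix]
  exact (h2F.comp 0 (hFd'.comp 0 h1)).fderiv

lemma spectralRadius_fderiv_recenter_lt_one [CompleteSpace H]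
    (hF : DifferentiableOn ℂ F (unitBall H)) {τ : H} (hτ : ‖τ‖ = 1)
    {m : ℝ} (hmaps : Set.MapsTo F (unitBall H) (ellipsoid τ m)) (hζ : ‖ζ‖ < 1) (hfix : F ζ = ζ)
    (hspec : peripheralSpectrum (fderiv ℂ F ζ) ⊆ pointSpectrum (fderiv ℂ F ζ)) :
    spectralRadius ℂ (fderiv ℂ (recenter F ζ) 0) < 1 := by
  have hmaps' : Set.MapsTo F (unitBall H) (unitBall H) := fun z hz => (hmaps hz).1
  have : Nontrivial H := ⟨τ, 0, fun h => by rw [h, norm_zero] at hτ; exact zero_ne_one hτ⟩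
  have hG := differentiableOn_recenter hF hmaps' hζ
  have hB : ‖fderiv ℂ (recenter F ζ) 0‖ ≤ 1 :=
    Complex.norm_fderiv_le_one_of_mapsTo_ball hG (by
      rw [recenter_zero hζ hfix]
      exact (mapsTo_recenter hmaps' hζ).mono_right Metric.ball_subset_closedBall) one_pos
  obtain ⟨u, hu⟩ := exists_unit_fderiv_recenter hF hζ hfix
  refine spectrum.spectralRadius_lt_of_forall_lt (r := 1) _ fun k hk => ?_
  have hk1 : ‖k‖ ≤ 1 := (spectrum.norm_le_norm_of_mem hk).trans hB
  refine lt_of_le_of_ne (by exact_mod_cast hk1) fun hne => ?_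
  have hk' : ‖k‖ = 1 := congrArg NNReal.toReal hne
  rw [hu, spectrum.units_conjugate] at hk
  obtain ⟨v, hv⟩ := (hspec ⟨hk, hk'⟩).2.exists_hasEigenvector
  have hAv : fderiv ℂ F ζ v = k • v := hv.apply_eq_smul
  have hBx : fderiv ℂ (recenter F ζ) 0 ((u : H →L[ℂ] H) v) = k • (u : H →L[ℂ] H) v := by
    have hinv : ((u⁻¹ : (H →L[ℂ] H)ˣ) : H →L[ℂ] H) ((u : H →L[ℂ] H) v) = v := by
      rw [← mul_apply_eq_comp, Units.inv_mul, one_apply_eq_self]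
    rw [hu, mul_apply_eq_comp, hinv, mul_apply_eq_comp, hAv, map_smul]
  set x := (u : H →L[ℂ] H) v with hx
  have hx0 : x ≠ 0 := by
    intro h
    apply hv.2
    have hinv : ((u⁻¹ : (H →L[ℂ] H)ˣ) : H →L[ℂ] H) x = v := by
      rw [hx, ← mul_apply_eq_comp, Units.inv_mul, one_apply_eq_self]
    rw [← hinv, h, map_zero]
  have h := norm_dslope_recenter_lt_one hF hτ hmaps hζ hfix (norm_inv_norm_smul hx0) (l := 0)
    (by simp)
  rw [dslope_same, deriv_comp_smul hG, map_smul, hBx, smul_comm, norm_smul, hk', one_mul,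
    norm_inv_norm_smul hx0] at h
  exact lt_irrefl _ h

/-- Convergence of the iterates to an interior fixed point, on smaller balls. -/
theorem tendstoUniformlyOn_iterate_of_fixedPoint [CompleteSpace H]
    (hF : DifferentiableOn ℂ F (unitBall H)) {τ : H} (hτ : ‖τ‖ = 1)
    {m : ℝ} (hmaps : Set.MapsTo F (unitBall H) (ellipsoid τ m)) (hζ : ‖ζ‖ < 1) (hfix : F ζ = ζ)
    (hspec : peripheralSpectrum (fderiv ℂ F ζ) ⊆ pointSpectrum (fderiv ℂ F ζ)) {R : ℝ}
    (hR : R < 1) :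
    TendstoUniformlyOn (fun n => F^[n]) (fun _ => ζ) atTop (Metric.closedBall 0 R) := by
  have hmaps' : Set.MapsTo F (unitBall H) (unitBall H) := fun z hz => (hmaps hz).1
  rcases lt_or_ge R 0 with hR0 | hR0
  · rw [Metric.closedBall_eq_empty.mpr hR0]
    exact tendstoUniformlyOn_empty
  have hG := differentiableOn_recenter hF hmaps' hζ
  have hGm := mapsTo_recenter hmaps' hζ
  have hG0 := recenter_zero hζ hfix
  obtain ⟨N, hN, hNq⟩ := exists_norm_pow_lt_one
    (spectralRadius_fderiv_recenter_lt_one hF hτ hmaps hζ hfix hspec)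
  set G := recenter F ζ with hGdef
  set q := ‖fderiv ℂ G 0 ^ N‖
  have hfd : fderiv ℂ G^[N] 0 = fderiv ℂ G 0 ^ N :=
    ((hG.differentiableAt (Metric.ball_mem_nhds _ one_pos)).hasFDerivAt.iterate hG0 N).fderiv
  have hGn : ∀ n, DifferentiableOn ℂ G^[n] (unitBall H) := fun n => by
    induction n with
    | zero => exact differentiableOn_id
    | succ n ih => exact ih.comp hG hGm
  have hle : ∀ n x, ‖x‖ < 1 → ‖G^[n] x‖ ≤ ‖x‖ := fun n x hx =>
    Complex.norm_le_norm_of_mapsTo_ball (hGn n)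
      ((hGm.iterate n).mono_right Metric.ball_subset_closedBall)
      (Function.iterate_fixed hG0 n) hx
  -- `mobius ζ` maps the ball of radius `R` into `‖x‖² ≤ 1 - s`
  set s := (1 - ‖ζ‖ ^ 2) * (1 - R ^ 2) / 4 with hs
  have hζ' := one_sub_norm_sq_pos hζ
  have hR' : 0 < 1 - R ^ 2 := by nlinarith
  have hspos : 0 < s := by positivity
  set κ := √(1 - s * (1 - q) ^ 2) with hκ
  have hκ0 : 0 ≤ κ := Real.sqrt_nonneg _
  have hκ1 : κ < 1 := by
    rw [hκ, Real.sqrt_lt' one_pos]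
    have : 0 < 1 - q := by linarith
    have : 0 < s * (1 - q) ^ 2 := by positivity
    linarith
  have hcontr : ∀ k x, ‖x‖ ^ 2 ≤ 1 - s → ‖(G^[N])^[k] x‖ ≤ κ ^ k := by
    intro k x hx
    have hx1 : ‖x‖ < 1 := by nlinarith [norm_nonneg x]
    induction k with
    | zero => simpa using hx1.le
    | succ k ih =>
      rw [Function.iterate_succ_apply', pow_succ', ← Function.iterate_mul]
      rw [← Function.iterate_mul] at ih
      refine (norm_map_le_of_norm_fderiv_le (hGn N) (hGm.iterate N) (Function.iterate_fixed hG0 N)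
        hNq (by rw [hfd]) hspos ?_).trans ?_
      · exact (pow_le_pow_left₀ (norm_nonneg _) (hle _ x hx1) 2).trans hx
      · gcongr
  rw [Metric.tendstoUniformlyOn_iff]
  intro ε hε
  obtain ⟨δ, hδ, hδε⟩ := Metric.continuousAt_iff.mp
    (differentiableAt_mobius hζ (z := 0) (by simp)).continuousAt ε hε
  have hpow : Tendsto (fun n : ℕ => κ ^ (n / N)) atTop (𝓝 0) :=
    (tendsto_pow_atTop_nhds_zero_of_lt_one hκ0 hκ1).comp (Nat.tendsto_div_const_atTop hN.ne')
  filter_upwards [hpow.eventually_lt_const hδ] with n hn z hz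
  have hzR : ‖z‖ ≤ R := mem_closedBall_zero_iff.mp hz
  have hz1 : ‖z‖ < 1 := hzR.trans_lt hR
  rw [iterate_eq_mobius_recenter hmaps' hζ hz1, dist_comm]
  have hw1 := norm_mobius_lt_one hζ hz1
  have hws : ‖mobius ζ z‖ ^ 2 ≤ 1 - s := by
    have h1 := one_sub_norm_mobius_sq hζ hz1.le
    have h2 := norm_one_sub_inner_le_two hζ.le hz1.le
    have h3 := norm_one_sub_pos (norm_inner_lt_one hζ hz1.le)
    have h4 : s ≤ sigma ζ z := by
      rw [hs, sigma]
      have : ‖1 - inner ℂ ζ z‖ ^ 2 ≤ 4 := by nlinarith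
      have := one_sub_norm_sq_pos hz1
      gcongr
    linarith
  have hsmall : ‖G^[n] (mobius ζ z)‖ < δ := by
    rw [← Nat.mod_add_div n N, Function.iterate_add_apply, Function.iterate_mul]
    refine (hle _ _ ?_).trans_lt ((hcontr _ _ hws).trans_lt hn)
    rw [← Function.iterate_mul]
    exact (hle _ _ hw1).trans_lt hw1
  have := hδε (x := G^[n] (mobius ζ z)) (by rwa [dist_zero_right])
  rwa [mobius_zero] at this

end Recenter

/-! ### Balls strictly inside the unit ball -/

lemma exists_subset_closedBall_of_isStrictlyInside [Nontrivial H] {K : Set H}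
    (hK : IsStrictlyInside K (unitBall H)) : ∃ R < 1, K ⊆ Metric.closedBall 0 R := by
  obtain ⟨hsub, ε, hε, hd⟩ := hK
  refine ⟨max 0 (1 - ε), max_lt one_pos (by linarith), fun z hz => ?_⟩
  rw [mem_closedBall_zero_iff]
  rcases eq_or_ne z 0 with rfl | hz0
  · simp
  have he := norm_inv_norm_smul hz0
  have hn : 0 < ‖z‖ := norm_pos_iff.mpr hz0
  have h1 := hd z hz (((‖z‖⁻¹ : ℝ) : ℂ) • z) (by
    rw [frontier_ball (0 : H) one_ne_zero]
    exact mem_sphere_zero_iff_norm.mpr he)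
  have h2 : z - ((‖z‖⁻¹ : ℝ) : ℂ) • z = ((‖z‖ - 1 : ℝ) : ℂ) • ((‖z‖⁻¹ : ℝ) : ℂ) • z := by
    rw [smul_smul, ← Complex.ofReal_mul, sub_mul, mul_inv_cancel₀ hn.ne']
    push_cast
    module
  have hz1 := mem_ball_zero_iff.mp (hsub hz)
  rw [h2, norm_smul, he, mul_one, Complex.norm_real, Real.norm_of_nonpos (by linarith)] at h1
  exact le_max_of_le_right (by linarith)

lemma isStrictlyInside_ball {E : Type*} [NormedAddCommGroup E] [NormedSpace ℝ E] {z : E} {r : ℝ}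
    (hr : ‖z‖ + r < 1) :
    IsStrictlyInside (Metric.ball z r) (unitBall E) := by
  have hn : ∀ x ∈ Metric.ball z r, ‖x‖ < ‖z‖ + r := fun x hx => by
    have h1 := norm_add_le z (x - z)
    rw [add_sub_cancel] at h1
    rw [Metric.mem_ball, dist_eq_norm] at hx
    linarith
  refine ⟨fun x hx => mem_ball_zero_iff.mpr ((hn x hx).trans hr), 1 - (‖z‖ + r), by linarith,
    fun x hx w hw => ?_⟩
  have hw1 : ‖w‖ = 1 := by
    have := Metric.frontier_ball_subset_sphere hw
    rwa [mem_sphere_zero_iff_norm] at this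
  have h1 := norm_sub_norm_le w x
  rw [norm_sub_rev] at h1
  linarith [hn x hx]

end HilbertBall

end

theorem theorem1 {H : Type*} [NormedAddCommGroup H] [InnerProductSpace ℂ H] [CompleteSpace H]
    (F : H → H) (hF : DifferentiableOn ℂ F (HilbertBall.unitBall H))
    (τ : H) (hτ : ‖τ‖ = 1) (m : ℝ) (hm : 0 < m)
    (hmaps : Set.MapsTo F (HilbertBall.unitBall H) (HilbertBall.ellipsoid τ m)) :
    -- (i) at most one fixed point in the ball
    (∀ z ∈ HilbertBall.unitBall H, ∀ w ∈ HilbertBall.unitBall H, F z = z → F w = w → z = w) ∧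
    -- (ii) convergence of the iterates to an interior fixed point
    (∀ ζ ∈ HilbertBall.unitBall H, F ζ = ζ →
      HilbertBall.peripheralSpectrum (fderiv ℂ F ζ) ⊆ HilbertBall.pointSpectrum (fderiv ℂ F ζ) →
      HilbertBall.LocallyUniformlyConvergesOn (fun n => F^[n]) (fun _ => ζ)
        (HilbertBall.unitBall H)) ∧
    -- (iii) a boundary regular fixed point can only be `τ`
    (∀ η : H, HilbertBall.IsBoundaryRegularFixedPoint F η → η = τ) ∧
    -- (iv) the fixed point free case
    ((∀ z ∈ HilbertBall.unitBall H, F z ≠ z) ↔ HilbertBall.IsSinkPoint F τ) ∧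
    (HilbertBall.IsSinkPoint F τ ↔
      HilbertBall.LocallyUniformlyConvergesOn (fun n => F^[n]) (fun _ => τ)
        (HilbertBall.unitBall H)) := by

  open HilbertBall in
  have hmaps' : Set.MapsTo F (unitBall H) (unitBall H) := fun z hz => (hmaps hz).1
  have hnt : Nontrivial H := ⟨τ, 0, fun h => by rw [h, norm_zero] at hτ; exact zero_ne_one hτ⟩
  have hconv : IsSinkPoint F τ →
      LocallyUniformlyConvergesOn (fun n => F^[n]) (fun _ => τ) (unitBall H) :=
    fun hs c r hcr => (tendstoUniformlyOn_iterate_of_isSinkPoint hF hm hmaps hs).mono hcr.1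
  have hfree : LocallyUniformlyConvergesOn (fun n => F^[n]) (fun _ => τ) (unitBall H) →
      ∀ z ∈ unitBall H, F z ≠ z := by
    intro h z hz hfix
    have hz1 := mem_ball_zero_iff.mp hz
    have hpos : 0 < (1 - ‖z‖) / 2 := by linarith
    have h1 := (h z ((1 - ‖z‖) / 2) (isStrictlyInside_ball (by linarith))).tendsto_at
      (Metric.mem_ball_self hpos)
    simp only [Function.iterate_fixed hfix] at h1
    rw [tendsto_nhds_unique tendsto_const_nhds h1, hτ] at hz1
    exact lt_irrefl _ hz1
  have hsink : (∀ z ∈ unitBall H, F z ≠ z) → IsSinkPoint F τ := fun h =>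
    ⟨hτ, fun k _ z hz => ⟨hmaps' hz.1, (horoDist_map_le_of_fixedPoint_free hF hτ hmaps h
      (mem_ball_zero_iff.mp hz.1)).trans_lt hz.2⟩⟩
  refine ⟨fun z hz w hw hfz hfw => eq_of_fixedPoints hF hτ hmaps (mem_ball_zero_iff.mp hz) hfz
    (mem_ball_zero_iff.mp hw) hfw, fun ζ hζ hfix hspec c r hcr => ?_, fun η hη => ?_,
    ⟨hsink, fun h => hfree (hconv h)⟩, ⟨hconv, fun h => hsink (hfree h)⟩⟩
  · obtain ⟨R, hR, hsub⟩ := exists_subset_closedBall_of_isStrictlyInside hcr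
    exact (tendstoUniformlyOn_iterate_of_fixedPoint hF hτ hmaps (mem_ball_zero_iff.mp hζ) hfix
      hspec hR).mono hsub
  · refine eq_of_tendsto_of_mem_ellipsoid (m := m) hτ ?_ hη.1.1 hη.1.2
    filter_upwards [Ioo_mem_nhdsLT (zero_lt_one' ℝ)] with r hr
    refine hmaps (mem_ball_zero_iff.mpr ?_)
    rw [norm_smul, hη.1.1, mul_one, Complex.norm_real, Real.norm_of_nonneg hr.1.le]
    exact hr.2
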